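/- There is an absolute constant $K$ such that every finite simple graph $G$ with $b$ branches has at most $K\,b^3$ stems; that is, $G$ has $O(b^3)$ stems. The terms are defined as follows. A *branch* of $G$ is a maximal path with at least one edge, or cycle, in which every internal vertex has degree two in $G$. (In a cycle, every vertex except one end vertex counts as internal, so a cycle is a branch when at most one of its vertices has degree other than two.) Along each branch $A$ fix a coordinate: traverse $A$ once from one end to the other (for a cycle, from an end vertex back to itself, all other vertices having degree two) and let the position of a vertex be the number of steps taken when it is reached, so that the vertices of $A$ have the positions $0,1,\dots,\mathrm{length}(A)$, the end vertex of a cycle having the two positions $0$ and $\mathrm{length}(A)$. The bound holds for every choice of these coordinates, with the same $K$. For a vertex $s$ and branches $A,B$ (possibly equal), the *indistinct set* of $s,A,B$ is the set of pairs $(a,b)$ of vertices with $a\in A$, $b\in B$ and $d(s,a)=d(s,b)$, where $d$ is the graph distance ($\infty$ between different components). It is plotted as a set of integer points in the plane, using the position of $a$ in $A$ and the position of $b$ in $B$ as Cartesian coordinates. Its *diagonals* are the line segments spanned by the maximal runs of consecutive points of this plot on lines of slope $\pm1$; a point that lies in no longer run is a one-point diagonal, to which both slopes are assigned. Two indistinct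 sets are *combinatorially equivalent* (have the same combinatorial structure) if there is a bijection between their diagonals such that corresponding diagonals have the same slope; two diagonals intersect if and only if the corresponding ones do; and, whenever distinct diagonals $t$ and $u$ both intersect a third diagonal $s$, the two intersection points along $s$ have the same order, from left to right, as the corresponding two intersection points. A *stem* is a nonempty contiguous (that is, connected within the branch) set of vertices of a branch $C$ that is maximal with the property that, for every pair $(A,B)$ of branches, the indistinct sets of $s,A,B$ for all $s$ in this set have the same combinatorial structure. Stems are counted separately for each branch $C$ of which they are a part. -/

import Mathlib

namespace SimpleGraph

universe u

variable {V : Type u}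

section Branches

variable (G : SimpleGraph V)

/-- A path with at least one edge, or a cycle, all of whose internal vertices (the vertices other
than the two end vertices of the walk; for a cycle these coincide) have degree two in `G`. -/
def IsBranchWalk {x y : V} (w : G.Walk x y) : Prop :=
  ((w.IsPath ∧ 0 < w.length) ∨ ∃ h : x = y, (w.copy rfl h.symm).IsCycle) ∧
    ∀ v ∈ w.support, v ≠ x → v ≠ y → (G.neighborSet v).ncard = 2

/-- A branch: a maximal path or cycle all of whose internal vertices have degree two in `G`. -/
def IsBranch (H : G.Subgraph) : Prop :=
  Maximal (fun K : G.Subgraph =>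
    ∃ (x y : V) (w : G.Walk x y), G.IsBranchWalk w ∧ w.toSubgraph = K) H

/-- The branches of `G`. -/
abbrev Branch : Type u := {H : G.Subgraph // G.IsBranch H}

variable {G}

/-- A coordinate on a branch: a walk that traverses the branch once. The vertex reached after
`i` steps has position `i`. On a cycle, the vertex at which the walk starts and ends
has the two positions `0` and `length`. -/
structure Branch.Coordinate (A : G.Branch) where
  first : V
  last : V
  walk : G.Walk first last
  isBranchWalk : G.IsBranchWalk walk
  toSubgraph_eq : walk.toSubgraph = A.1

/-- The indistinct set of `s`, `A`, `B`: the pairs of vertices of `A` and `B` with the same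
distance (possibly infinite) from `s`. -/
def indistinctSet (s : V) (A B : G.Branch) : Set (V × V) :=
  {p | p.1 ∈ A.1.verts ∧ p.2 ∈ B.1.verts ∧ G.edist s p.1 = G.edist s p.2}

/-- The plot of the indistinct set of `s`, `A`, `B` in the plane, the position of the first vertex
in `A` and the position of the second vertex in `B` being the Cartesian coordinates. -/
def indistinctPlot (P : ∀ A : G.Branch, A.Coordinate) (s : V) (A B : G.Branch) : Set (ℤ × ℤ) :=
  {q | ∃ i j : ℕ, i ≤ (P A).walk.length ∧ j ≤ (P B).walk.length ∧ q = ((i : ℤ), (j : ℤ)) ∧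
    ((P A).walk.getVert i, (P B).walk.getVert j) ∈ indistinctSet s A B}

end Branches

section Diagonals

/-- `n + 1` consecutive integer points on a line of slope `1` or `-1`. -/
def IsDiagonalRun (D : Set (ℤ × ℤ)) : Prop :=
  ∃ (p : ℤ × ℤ) (σ : ℤ) (n : ℕ), (σ = 1 ∨ σ = -1) ∧
    D = {q | ∃ k : ℕ, k ≤ n ∧ q = (p.1 + k, p.2 + σ * k)}

/-- A diagonal of a set `I` of integer points: a maximal diagonal run inside `I`, recorded by its
integer points. A point of `I` that lies in no longer run is a (one-point) diagonal. -/
def IsDiagonal (I D : Set (ℤ × ℤ)) : Prop :=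
  Maximal (fun E : Set (ℤ × ℤ) => IsDiagonalRun E ∧ E ⊆ I) D

/-- `D` lies on a line of slope `σ`. One-point sets have every slope. -/
def HasSlope (D : Set (ℤ × ℤ)) (σ : ℤ) : Prop :=
  ∀ p ∈ D, ∀ q ∈ D, q.2 - p.2 = σ * (q.1 - p.1)

/-- The line segment in the real plane that is spanned by the integer points of a diagonal. -/
def realSegment (D : Set (ℤ × ℤ)) : Set (ℝ × ℝ) :=
  convexHull ℝ ((fun q : ℤ × ℤ => ((q.1 : ℝ), (q.2 : ℝ))) '' D)

/-- Combinatorial equivalence: a bijection between the diagonals that preserves the slopes,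
which diagonals intersect, and the order of any two intersection points along a common diagonal
(an order which, on a line of slope `1` or `-1`, is that of the first coordinates). -/
def CombEquiv (I J : Set (ℤ × ℤ)) : Prop :=
  ∃ e : {D // IsDiagonal I D} ≃ {D // IsDiagonal J D},
    (∀ (D : {D // IsDiagonal I D}) (σ : ℤ), HasSlope D.1 σ ↔ HasSlope (e D).1 σ) ∧
    (∀ D E : {D // IsDiagonal I D},
      (realSegment D.1 ∩ realSegment E.1).Nonempty ↔
        (realSegment (e D).1 ∩ realSegment (e E).1).Nonempty) ∧
    (∀ D E F : {D // IsDiagonal I D}, D ≠ E → D ≠ F → E ≠ F →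
      ∀ p ∈ realSegment D.1 ∩ realSegment E.1, ∀ q ∈ realSegment D.1 ∩ realSegment F.1,
      ∀ p' ∈ realSegment (e D).1 ∩ realSegment (e E).1,
      ∀ q' ∈ realSegment (e D).1 ∩ realSegment (e F).1,
        (p.1 < q.1 ↔ p'.1 < q'.1))

end Diagonals

section Stems

variable {G : SimpleGraph V}

/-- A nonempty contiguous subset `S` of the branch `C` such that, for every pair of branches, the
indistinct sets of all points of `S` have the same combinatorial structure. -/
def IsStructurallyUniform (P : ∀ A : G.Branch, A.Coordinate) (C : G.Branch) (S : Set V) : Prop :=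
  S ⊆ C.1.verts ∧ (C.1.induce S).Connected ∧
    ∀ A B : G.Branch, ∀ s ∈ S, ∀ t ∈ S,
      CombEquiv (indistinctPlot P s A B) (indistinctPlot P t A B)

/-- A stem of the branch `C`: a maximal set as in `IsStructurallyUniform`. -/
def IsStem (P : ∀ A : G.Branch, A.Coordinate) (C : G.Branch) (S : Set V) : Prop :=
  Maximal (IsStructurallyUniform P C) S

/-- The stems of `G`, each together with the branch of which it is a part. -/
def stems (P : ∀ A : G.Branch, A.Coordinate) : Set (G.Branch × Set V) :=
  {x | IsStem P x.1 x.2}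

end Stems

end SimpleGraph

/-! Let s be at position x of a branch C. A walk can leave a branch only through its ends. Hence the
distance from s to position i of another branch A is min(α + i, β + ℓ - i), where ℓ is the length of
A and α, β are the distances from s to its ends, themselves minima of an increasing and a decreasing
affine function of x. If A = C the distance is min(|x - i|, M - |x - i|), with M the length of C
plus the distance between its ends. So an indistinct set is a level set f(i) = g(j) in a box, where
f and g have slope ±1 except at boundedly many break points, and these are piecewise affine in x
with a bounded number of pieces.

Away from the rows and columns of break points, one of the two diagonal directions continues on both
sides. Every diagonal therefore ends in such a row or column, and its ends lie in a list of
candidates of fixed size, each piecewise affine in x. Which pairs of candidates bound a diagonal,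
which diagonals meet, and in what order they meet a third one is decided by a fixed number of
comparisons between piecewise affine functions. Each comparison changes a bounded number of times
(`card_sign_changes_le`), so for fixed C, A, B the structure changes at most N times along C, with N
absolute. The filter `unifCofinite` carries this uniformity, so that no constants need to be
tracked.

Distinct stems of C are disjoint, and each has a last position, which is the end of C or a change
for some pair (A, B). With b branches this gives at most b(N b² + 1) ≤ (N + 1) b³ stems. -/

namespace SimpleGraph

/-! ### Diagonals as integer runs, and a criterion for combinatorial equivalence -/

section DiagonalGeometry

/-- The integer points with first coordinate between those of `p` and `q` on the line of
slope `σ` through `p`. -/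
def diagRun (p q : ℤ × ℤ) (σ : ℤ) : Set (ℤ × ℤ) :=
  {r | p.1 ≤ r.1 ∧ r.1 ≤ q.1 ∧ r.2 - p.2 = σ * (r.1 - p.1)}

/-- `p` and `q` are the left and right end points of a run of slope `σ` inside `I` that cannot be
extended inside `I`. -/
structure IsEndpoints (I : Set (ℤ × ℤ)) (p q : ℤ × ℤ) (σ : ℤ) : Prop where
  le : p.1 ≤ q.1
  slope : q.2 - p.2 = σ * (q.1 - p.1)
  subset : ∀ i, p.1 ≤ i → i ≤ q.1 → (i, p.2 + σ * (i - p.1)) ∈ I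
  left : (p.1 - 1, p.2 - σ) ∉ I
  right : (q.1 + 1, q.2 + σ) ∉ I
  single : p.1 = q.1 → (p.1 - 1, p.2 + σ) ∉ I ∧ (p.1 + 1, p.2 - σ) ∉ I

/-- The intercept of the line of slope `σ` through `p`. -/
def intercept (p : ℤ × ℤ) (σ : ℤ) : ℤ := p.2 - σ * p.1

variable {I : Set (ℤ × ℤ)} {p q : ℤ × ℤ} {σ : ℤ}

lemma IsEndpoints.left_mem (h : IsEndpoints I p q σ) : p ∈ diagRun p q σ := by
  simp [diagRun, h.le]

lemma IsEndpoints.right_mem (h : IsEndpoints I p q σ) : q ∈ diagRun p q σ := by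
  simp [diagRun, h.le, h.slope]

lemma IsEndpoints.diagRun_subset (h : IsEndpoints I p q σ) : diagRun p q σ ⊆ I := by
  rintro ⟨i, j⟩ ⟨h1, h2, h3⟩
  have := h.subset i h1 h2
  simp only at h1 h2 h3
  rwa [← h3, add_sub_cancel] at this

lemma isDiagonalRun_diagRun (hσ : σ = 1 ∨ σ = -1) (hle : p.1 ≤ q.1) :
    IsDiagonalRun (diagRun p q σ) := by
  refine ⟨p, σ, (q.1 - p.1).toNat, hσ, ?_⟩
  ext ⟨i, j⟩
  simp only [diagRun, Set.mem_ofPred_eq, Prod.mk.injEq]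
  constructor
  · rintro ⟨h1, h2, h3⟩
    refine ⟨(i - p.1).toNat, by omega, by omega, ?_⟩
    rw [Int.toNat_of_nonneg (by omega)]
    linarith
  · rintro ⟨k, hk, rfl, rfl⟩
    refine ⟨by omega, by omega, by ring⟩

lemma IsDiagonalRun.exists_eq_diagRun {D : Set (ℤ × ℤ)} (h : IsDiagonalRun D) :
    ∃ p q : ℤ × ℤ, ∃ σ : ℤ, (σ = 1 ∨ σ = -1) ∧ p.1 ≤ q.1 ∧ q.2 - p.2 = σ * (q.1 - p.1) ∧
      D = diagRun p q σ := by
  obtain ⟨p, σ, n, hσ, rfl⟩ := h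
  refine ⟨p, (p.1 + n, p.2 + σ * n), σ, hσ, by simp, by simp, ?_⟩
  ext ⟨i, j⟩
  simp only [diagRun, Set.mem_ofPred_eq, Prod.mk.injEq]
  constructor
  · rintro ⟨k, hk, rfl, rfl⟩
    refine ⟨by omega, by omega, by ring⟩
  · rintro ⟨h1, h2, h3⟩
    refine ⟨(i - p.1).toNat, by omega, by omega, ?_⟩
    rw [Int.toNat_of_nonneg (by omega)]
    linarith

/-- A run that contains a run with non-extendable end points is not longer. -/
lemma IsEndpoints.eq_of_subset {p' q' : ℤ × ℤ} {σ' : ℤ} (hσ : σ = 1 ∨ σ = -1)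
    (hσ' : σ' = 1 ∨ σ' = -1) (h : IsEndpoints I p q σ) (hI : diagRun p' q' σ' ⊆ I)
    (hsub : diagRun p q σ ⊆ diagRun p' q' σ') : diagRun p' q' σ' ⊆ diagRun p q σ := by
  obtain ⟨p1, p2⟩ := p
  obtain ⟨q1, q2⟩ := q
  obtain ⟨r1, r2⟩ := p'
  obtain ⟨s1, s2⟩ := q'
  have hp := hsub h.left_mem
  have hq := hsub h.right_mem
  have hle := h.le
  have hslope := h.slope
  have hl := h.left
  have hr := h.right
  have hs := h.single
  have key : ∀ i, r1 ≤ i → i ≤ s1 → (i, r2 + σ' * (i - r1)) ∈ I := fun i h1 h2 =>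
    hI ⟨h1, h2, by simp⟩
  simp only [diagRun, Set.mem_ofPred_eq] at hp hq hle hslope hl hr hs
  have kl := key (p1 - 1)
  have kr := key (q1 + 1)
  rcases eq_or_lt_of_le hle with heq | hlt
  · obtain ⟨hs1, hs2⟩ := hs heq
    have e2 : p2 = q2 := by rcases hσ with rfl | rfl <;> omega
    subst heq e2
    have h1 : r1 = p1 := by
      by_contra hne
      have := kl (by omega) (by omega)
      rcases hσ with rfl | rfl <;> rcases hσ' with rfl | rfl
      · exact hl (by convert this using 2; omega)
      · exact hs1 (by convert this using 2; omega)
      · exact hs1 (by convert this using 2; omega)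
      · exact hl (by convert this using 2; omega)
    have h2 : s1 = p1 := by
      by_contra hne
      have := kr (by omega) (by omega)
      rcases hσ with rfl | rfl <;> rcases hσ' with rfl | rfl
      · exact hr (by convert this using 2; omega)
      · exact hs2 (by convert this using 2; omega)
      · exact hs2 (by convert this using 2; omega)
      · exact hr (by convert this using 2; omega)
    rintro ⟨i, j⟩ ⟨g1, g2, g3⟩
    simp only [diagRun, Set.mem_ofPred_eq] at *
    have : i = p1 := by omega
    subst this h1
    refine ⟨g1, hle, ?_⟩
    simp only [sub_self, mul_zero] at hp g3 ⊢
    omega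
  · have hσσ : σ' = σ := by
      rcases hσ with rfl | rfl <;> rcases hσ' with rfl | rfl <;> omega
    subst hσσ
    have h1 : r1 = p1 := by
      by_contra hne
      have := kl (by omega) (by omega)
      apply hl
      convert this using 2
      rcases hσ with rfl | rfl <;> omega
    have h2 : s1 = q1 := by
      by_contra hne
      have := kr (by omega) (by omega)
      apply hr
      convert this using 2
      rcases hσ with rfl | rfl <;> omega
    subst h1 h2
    rintro ⟨i, j⟩ ⟨g1, g2, g3⟩
    simp only [diagRun, Set.mem_ofPred_eq] at *
    refine ⟨g1, g2, ?_⟩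
    rcases hσ with rfl | rfl <;> omega

/-- A run of at least two points can only be extended in its own direction. For a one-point run the
field `single` also excludes the other slope. -/
lemma IsEndpoints.isDiagonal (hσ : σ = 1 ∨ σ = -1) (h : IsEndpoints I p q σ) :
    IsDiagonal I (diagRun p q σ) := by
  refine ⟨⟨isDiagonalRun_diagRun hσ h.le, h.diagRun_subset⟩, ?_⟩
  rintro E ⟨hE, hEI⟩ hsub
  obtain ⟨p', q', σ', hσ', -, -, rfl⟩ := hE.exists_eq_diagRun
  exact h.eq_of_subset hσ hσ' hEI hsub

lemma IsDiagonal.not_mem_extend {D : Set (ℤ × ℤ)} (hD : IsDiagonal I D) {p q : ℤ × ℤ} {σ : ℤ}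
    (hσ : σ = 1 ∨ σ = -1) (hle : p.1 ≤ q.1) (hsub : D ⊆ diagRun p q σ)
    (hI : diagRun p q σ ⊆ I) : diagRun p q σ ⊆ D :=
  hD.2 ⟨isDiagonalRun_diagRun hσ hle, hI⟩ hsub

lemma IsDiagonal.exists_isEndpoints {D : Set (ℤ × ℤ)} (hD : IsDiagonal I D) :
    ∃ p q : ℤ × ℤ, ∃ σ : ℤ, (σ = 1 ∨ σ = -1) ∧ IsEndpoints I p q σ ∧ D = diagRun p q σ := by
  obtain ⟨⟨p1, p2⟩, ⟨q1, q2⟩, σ, hσ, hle, hslope, rfl⟩ := hD.1.1.exists_eq_diagRun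
  refine ⟨(p1, p2), (q1, q2), σ, hσ, ?_, rfl⟩
  have hI := hD.1.2
  simp only at hle hslope
  have hext := @IsDiagonal.not_mem_extend I _ hD
  have extend_left : (p1 - 1, p2 - σ) ∉ I := by
    intro hmem
    have := (@hext (p1 - 1, p2 - σ) (q1, q2) σ hσ (by simp only; omega) ?_ ?_)
      (show (p1 - 1, p2 - σ) ∈ _ from ⟨by simp, by simp only; omega, by simp⟩)
    · have := this.1
      simp at this
    · rintro ⟨i, j⟩ ⟨g1, g2, g3⟩
      simp only at g1 g2 g3
      refine ⟨by simp only; omega, g2, ?_⟩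
      simp only
      rcases hσ with rfl | rfl <;> omega
    · rintro ⟨i, j⟩ ⟨g1, g2, g3⟩
      simp only at g1 g2 g3
      rcases eq_or_lt_of_le g1 with rfl | hlt
      · convert hmem using 2
        rcases hσ with rfl | rfl <;> omega
      · refine hI ⟨by simp only; omega, g2, ?_⟩
        simp only
        rcases hσ with rfl | rfl <;> omega
  have extend_right : (q1 + 1, q2 + σ) ∉ I := by
    intro hmem
    have := (@hext (p1, p2) (q1 + 1, q2 + σ) σ hσ (by simp only; omega) ?_ ?_)
      (show (q1 + 1, q2 + σ) ∈ _ from ⟨by simp only; omega, by simp, by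
        simp only; rcases hσ with rfl | rfl <;> omega⟩)
    · have := this.2.1
      simp at this
    · rintro ⟨i, j⟩ ⟨g1, g2, g3⟩
      simp only at g1 g2 g3
      exact ⟨g1, by simp only; omega, g3⟩
    · rintro ⟨i, j⟩ ⟨g1, g2, g3⟩
      simp only at g1 g2 g3
      rcases eq_or_lt_of_le g2 with rfl | hlt
      · convert hmem using 2
        rcases hσ with rfl | rfl <;> omega
      · exact hI ⟨g1, by simp only; omega, g3⟩
  refine ⟨hle, hslope, fun i h1 h2 => hI ⟨h1, h2, by simp⟩, extend_left, extend_right, ?_⟩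
  intro heq
  simp only at heq
  subst heq
  have e2 : q2 = p2 := by rcases hσ with rfl | rfl <;> omega
  subst e2
  have hσ' : -σ = 1 ∨ -σ = -1 := by omega
  have hmem0 : (p1, q2) ∈ I := hI ⟨by simp, by simp, by simp⟩
  constructor
  · intro hmem
    have := (@hext (p1 - 1, q2 + σ) (p1, q2) (-σ) hσ' (by simp) ?_ ?_)
      (show (p1 - 1, q2 + σ) ∈ _ from ⟨by simp, by simp, by simp⟩)
    · have := this.1
      simp at this
    · rintro ⟨i, j⟩ ⟨g1, g2, g3⟩
      simp only at g1 g2 g3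
      refine ⟨by simp only; omega, g2, ?_⟩
      simp only
      rcases hσ with rfl | rfl <;> omega
    · rintro ⟨i, j⟩ ⟨g1, g2, g3⟩
      simp only at g1 g2 g3
      have : i = p1 - 1 ∨ i = p1 := by omega
      rcases this with rfl | rfl
      · convert hmem using 2
        rcases hσ with rfl | rfl <;> omega
      · convert hmem0 using 2
        rcases hσ with rfl | rfl <;> omega
  · intro hmem
    have := (@hext (p1, q2) (p1 + 1, q2 - σ) (-σ) hσ' (by simp) ?_ ?_)
      (show (p1 + 1, q2 - σ) ∈ _ from ⟨by simp, by simp, by simp⟩)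
    · have := this.2.1
      simp at this
    · rintro ⟨i, j⟩ ⟨g1, g2, g3⟩
      simp only at g1 g2 g3
      refine ⟨g1, by simp only; omega, ?_⟩
      simp only
      rcases hσ with rfl | rfl <;> omega
    · rintro ⟨i, j⟩ ⟨g1, g2, g3⟩
      simp only at g1 g2 g3
      have : i = p1 + 1 ∨ i = p1 := by omega
      rcases this with rfl | rfl
      · convert hmem using 2
        rcases hσ with rfl | rfl <;> omega
      · convert hmem0 using 2
        rcases hσ with rfl | rfl <;> omega

/-- The right-hand side is convex and contains the integer points; conversely the hull contains the
segment from `p` to `q`. This replaces convex hulls by linear inequalities. -/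
lemma mem_realSegment_diagRun (hle : p.1 ≤ q.1) (hslope : q.2 - p.2 = σ * (q.1 - p.1))
    (z : ℝ × ℝ) :
    z ∈ realSegment (diagRun p q σ) ↔
      (p.1 : ℝ) ≤ z.1 ∧ z.1 ≤ q.1 ∧ z.2 = intercept p σ + σ * z.1 := by
  have hslope' : (q.2 : ℝ) - p.2 = σ * (q.1 - p.1) := by exact_mod_cast hslope
  have hle' : (p.1 : ℝ) ≤ q.1 := by exact_mod_cast hle
  constructor
  · intro hz
    let W : Set (ℝ × ℝ) :=
      {z | (p.1 : ℝ) ≤ z.1 ∧ z.1 ≤ q.1 ∧ z.2 = intercept p σ + σ * z.1}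
    have hW : Convex ℝ W := by
      rintro ⟨x1, x2⟩ ⟨a1, a2, a3⟩ ⟨y1, y2⟩ ⟨b1, b2, b3⟩ a b ha hb hab
      simp only at a1 a2 a3 b1 b2 b3
      refine ⟨?_, ?_, ?_⟩
      · simp only [Prod.fst_add, Prod.smul_fst, smul_eq_mul]
        calc (p.1 : ℝ) = a * p.1 + b * p.1 := by rw [← add_mul, hab, one_mul]
          _ ≤ _ := by gcongr
      · simp only [Prod.fst_add, Prod.smul_fst, smul_eq_mul]
        calc a * x1 + b * y1 ≤ a * q.1 + b * q.1 := by gcongr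
          _ = _ := by rw [← add_mul, hab, one_mul]
      · simp only [Prod.fst_add, Prod.smul_fst, Prod.snd_add, Prod.smul_snd, smul_eq_mul, a3, b3]
        linear_combination (intercept p σ : ℝ) * hab
    refine convexHull_min ?_ hW hz
    rintro _ ⟨⟨i, j⟩, ⟨h1, h2, h3⟩, rfl⟩
    simp only at h1 h2 h3
    refine ⟨Int.cast_le.2 h1, Int.cast_le.2 h2, ?_⟩
    have h3' : (j : ℝ) - p.2 = σ * (i - p.1) := by exact_mod_cast h3
    simp only [intercept]
    push_cast
    linear_combination h3'
  · rintro ⟨h1, h2, h3⟩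
    have hp : ((p.1 : ℝ), (p.2 : ℝ)) ∈ realSegment (diagRun p q σ) :=
      subset_convexHull ℝ _ ⟨p, ⟨le_rfl, hle, by simp⟩, rfl⟩
    have hq : ((q.1 : ℝ), (q.2 : ℝ)) ∈ realSegment (diagRun p q σ) :=
      subset_convexHull ℝ _ ⟨q, ⟨hle, le_rfl, hslope⟩, rfl⟩
    refine (convex_convexHull ℝ _).segment_subset hp hq ?_
    simp only [intercept] at h3
    push_cast at h3
    rcases eq_or_lt_of_le hle' with heq | hlt
    · refine ⟨1, 0, by simp, by simp, by simp, ?_⟩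
      have e1 : z.1 = p.1 := by linarith
      ext
      · simp [e1]
      · simp [h3, e1]
    · have hd : (q.1 : ℝ) - p.1 ≠ 0 := by linarith
      have hd' : 0 < (q.1 : ℝ) - p.1 := by linarith
      refine ⟨(q.1 - z.1) / (q.1 - p.1), (z.1 - p.1) / (q.1 - p.1),
        div_nonneg (by linarith) hd'.le, div_nonneg (by linarith) hd'.le,
        by field_simp; ring, ?_⟩
      have e2 : (q.2 : ℝ) = p.2 + σ * (q.1 - p.1) := by linarith
      ext
      · simp
        field_simp
        ring
      · simp [h3, e2]
        field_simp
        ring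

/-- The condition in the integers for the segments of two runs to intersect. -/
def RunsMeet (p q : ℤ × ℤ) (σ : ℤ) (p' q' : ℤ × ℤ) (σ' : ℤ) : Prop :=
  (σ = σ' → intercept p σ = intercept p' σ' ∧ p.1 ≤ q'.1 ∧ p'.1 ≤ q.1) ∧
  (σ ≠ σ' → 2 * p.1 ≤ σ * (intercept p' σ' - intercept p σ) ∧
    σ * (intercept p' σ' - intercept p σ) ≤ 2 * q.1 ∧
    2 * p'.1 ≤ σ * (intercept p' σ' - intercept p σ) ∧
    σ * (intercept p' σ' - intercept p σ) ≤ 2 * q'.1)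

/-- Lines with intercepts c, c' and opposite slopes σ, -σ meet at the abscissa z with 2z = σ(c' -
c). It may be a half-integer, hence the factors 2 in `RunsMeet`. -/
lemma realSegment_inter_nonempty_iff {p' q' : ℤ × ℤ} {σ' : ℤ} (hσ : σ = 1 ∨ σ = -1)
    (hσ' : σ' = 1 ∨ σ' = -1) (hle : p.1 ≤ q.1) (hslope : q.2 - p.2 = σ * (q.1 - p.1))
    (hle' : p'.1 ≤ q'.1) (hslope' : q'.2 - p'.2 = σ' * (q'.1 - p'.1)) :
    (realSegment (diagRun p q σ) ∩ realSegment (diagRun p' q' σ')).Nonempty ↔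
      RunsMeet p q σ p' q' σ' := by
  constructor
  · rintro ⟨z, hz, hz'⟩
    rw [mem_realSegment_diagRun hle hslope] at hz
    rw [mem_realSegment_diagRun hle' hslope'] at hz'
    obtain ⟨a1, a2, a3⟩ := hz
    obtain ⟨b1, b2, b3⟩ := hz'
    refine ⟨?_, ?_⟩
    · rintro rfl
      refine ⟨?_, ?_, ?_⟩
      · have : (intercept p σ : ℝ) = intercept p' σ := by linarith
        exact_mod_cast this
      · have : (p.1 : ℝ) ≤ q'.1 := by linarith
        exact_mod_cast this
      · have : (p'.1 : ℝ) ≤ q.1 := by linarith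
        exact_mod_cast this
    · intro hne
      have hz1 : ((σ * (intercept p' σ' - intercept p σ) : ℤ) : ℝ) = 2 * z.1 := by
        rw [a3] at b3
        push_cast
        rcases hσ with rfl | rfl <;> rcases hσ' with rfl | rfl <;>
          first | exact absurd rfl hne | (push_cast at b3 ⊢; linarith)
      refine ⟨?_, ?_, ?_, ?_⟩ <;> rify <;> push_cast at hz1 <;> rw [hz1] <;> linarith
  · rintro ⟨h1, h2⟩
    by_cases he : σ = σ'
    · subst he
      obtain ⟨c1, c2, c3⟩ := h1 rfl
      have c2' : (p.1 : ℝ) ≤ q'.1 := by exact_mod_cast c2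
      have c3' : (p'.1 : ℝ) ≤ q.1 := by exact_mod_cast c3
      have d1 : (p.1 : ℝ) ≤ q.1 := by exact_mod_cast hle
      have d2 : (p'.1 : ℝ) ≤ q'.1 := by exact_mod_cast hle'
      refine ⟨(max p.1 p'.1, intercept p σ + σ * max (p.1 : ℝ) p'.1), ?_, ?_⟩
      · rw [mem_realSegment_diagRun hle hslope]
        exact ⟨le_max_left _ _, max_le d1 c3', rfl⟩
      · rw [mem_realSegment_diagRun hle' hslope', ← c1]
        exact ⟨le_max_right _ _, max_le c2' d2, rfl⟩
    · obtain ⟨c1, c2, c3, c4⟩ := h2 he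
      rify at c1 c2 c3 c4
      refine ⟨((σ : ℝ) * (intercept p' σ' - intercept p σ) / 2, intercept p σ +
        σ * (σ * (intercept p' σ' - intercept p σ) / 2)), ?_, ?_⟩
      · rw [mem_realSegment_diagRun hle hslope]
        exact ⟨by simp only; linarith, by simp only; linarith, rfl⟩
      · rw [mem_realSegment_diagRun hle' hslope']
        refine ⟨by simp only; linarith, by simp only; linarith, ?_⟩
        rcases hσ with rfl | rfl <;> rcases hσ' with rfl | rfl <;>
          first | exact absurd rfl he | (push_cast; ring)

/-- Runs of equal slope that meet lie on one line, and non-extendability makes them equal. So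
distinct diagonals meet only with opposite slopes, and the intercepts give the abscissa. -/
lemma two_mul_fst_of_mem_inter {p' q' : ℤ × ℤ} {σ' : ℤ} (hσ : σ = 1 ∨ σ = -1)
    (hσ' : σ' = 1 ∨ σ' = -1) (h : IsEndpoints I p q σ) (h' : IsEndpoints I p' q' σ')
    (hne : diagRun p q σ ≠ diagRun p' q' σ') {z : ℝ × ℝ}
    (hz : z ∈ realSegment (diagRun p q σ) ∩ realSegment (diagRun p' q' σ')) :
    ((σ * (intercept p' σ' - intercept p σ) : ℤ) : ℝ) = 2 * z.1 := by
  have hm := (realSegment_inter_nonempty_iff hσ hσ' h.le h.slope h'.le h'.slope).1 ⟨z, hz⟩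
  obtain ⟨hz1, hz2⟩ := hz
  rw [mem_realSegment_diagRun h.le h.slope] at hz1
  rw [mem_realSegment_diagRun h'.le h'.slope] at hz2
  obtain ⟨a1, a2, a3⟩ := hz1
  obtain ⟨b1, b2, b3⟩ := hz2
  by_cases he : σ = σ'
  · exfalso
    subst he
    obtain ⟨c1, c2, c3⟩ := hm.1 rfl
    have hle := h.le
    have hle' := h'.le
    simp only [intercept] at c1
    have hp : ¬ p.1 < p'.1 := by
      intro hlt
      apply h'.left
      convert h.subset (p'.1 - 1) (by omega) (by omega) using 2
      linear_combination -c1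
    have hp' : ¬ p'.1 < p.1 := by
      intro hlt
      apply h.left
      convert h'.subset (p.1 - 1) (by omega) (by omega) using 2
      linear_combination c1
    have hq : ¬ q.1 < q'.1 := by
      intro hlt
      apply h.right
      convert h'.subset (q.1 + 1) (by omega) (by omega) using 2
      linear_combination h.slope + c1
    have hq' : ¬ q'.1 < q.1 := by
      intro hlt
      apply h'.right
      convert h.subset (q'.1 + 1) (by omega) (by omega) using 2
      linear_combination h'.slope - c1
    have e1 : p.1 = p'.1 := by omega
    have e2 : q.1 = q'.1 := by omega
    have e3 : p.2 = p'.2 := by rw [e1] at c1; linarith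
    apply hne
    simp only [diagRun, e1, e2, e3]
  · rw [a3] at b3
    push_cast
    rcases hσ with rfl | rfl <;> rcases hσ' with rfl | rfl <;>
      first | exact absurd rfl he | (push_cast at b3 ⊢; linarith)

lemma hasSlope_diagRun_iff {I : Set (ℤ × ℤ)} (h : IsEndpoints I p q σ) (ρ : ℤ) :
    HasSlope (diagRun p q σ) ρ ↔ (p.1 = q.1 ∨ σ = ρ) := by
  constructor
  · intro hs
    have := hs p h.left_mem q h.right_mem
    rw [h.slope] at this
    by_contra! hc
    have hne : q.1 - p.1 ≠ 0 := by have := hc.1; omega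
    exact hc.2 (mul_right_cancel₀ hne this)
  · rintro (he | rfl)
    · rintro ⟨i, j⟩ ⟨a1, a2, a3⟩ ⟨i', j'⟩ ⟨b1, b2, b3⟩
      simp only at *
      have e1 : i = p.1 := by omega
      have e2 : i' = p.1 := by omega
      subst e1 e2
      simp at a3 b3 ⊢
      omega
    · rintro ⟨i, j⟩ ⟨a1, a2, a3⟩ ⟨i', j'⟩ ⟨b1, b2, b3⟩
      simp only at *
      linear_combination b3 - a3

/-- Slopes need no comparison: two different end points determine the slope, and for a one-point run
it is immaterial. -/
lemma IsEndpoints.diagRun_eq_iff {p' q' : ℤ × ℤ} {σ' : ℤ} (h : IsEndpoints I p q σ)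
    (h' : IsEndpoints I p' q' σ') :
    diagRun p q σ = diagRun p' q' σ' ↔ p = p' ∧ q = q' := by
  constructor
  · intro he
    have a1 := he ▸ h.left_mem
    have a2 := he ▸ h.right_mem
    have b1 := he.symm ▸ h'.left_mem
    have b2 := he.symm ▸ h'.right_mem
    have e1 : p'.1 = p.1 := le_antisymm a1.1 b1.1
    have e2 : q'.1 = q.1 := le_antisymm b2.2.1 a2.2.1
    have e3 : p.2 - p'.2 = σ' * (p.1 - p'.1) := a1.2.2
    have e4 : q'.2 - p.2 = σ * (q'.1 - p.1) := b2.2.2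
    have e5 := h.slope
    rw [e1, sub_self, mul_zero] at e3
    rw [e2] at e4
    exact ⟨Prod.ext e1.symm (by omega), Prod.ext e2.symm (by omega)⟩
  · rintro ⟨rfl, rfl⟩
    have : σ = σ' ∨ p.1 = q.1 := by
      by_cases he : p.1 = q.1
      · exact Or.inr he
      · left
        have h1 := h.slope
        rw [h'.slope] at h1
        exact (mul_right_cancel₀ (by omega) h1).symm
    rcases this with rfl | he
    · rfl
    · ext ⟨i, j⟩
      simp only [diagRun, Set.mem_ofPred_eq]
      constructor <;> rintro ⟨a1, a2, a3⟩ <;> refine ⟨a1, a2, ?_⟩ <;>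
      · have : i = p.1 := by omega
        subst this
        simpa using a3

/-- Two sets whose diagonals are given by runs with the same indices are combinatorially
equivalent when the end points of these runs compare in the same way. -/
theorem combEquiv_of_matching {T : Type*} {I J : Set (ℤ × ℤ)} {σ : T → ℤ}
    {P Q P' Q' : T → ℤ × ℤ} (hσ : ∀ t, σ t = 1 ∨ σ t = -1)
    (hI : ∀ D, IsDiagonal I D → ∃ t, IsEndpoints I (P t) (Q t) (σ t) ∧
      D = diagRun (P t) (Q t) (σ t))
    (hJ : ∀ D, IsDiagonal J D → ∃ t, IsEndpoints J (P' t) (Q' t) (σ t) ∧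
      D = diagRun (P' t) (Q' t) (σ t))
    (hIJ : ∀ t, IsEndpoints I (P t) (Q t) (σ t) ↔ IsEndpoints J (P' t) (Q' t) (σ t))
    (hP : ∀ t u, P t = P u ↔ P' t = P' u) (hQ : ∀ t u, Q t = Q u ↔ Q' t = Q' u)
    (hPQ : ∀ t, (P t).1 = (Q t).1 ↔ (P' t).1 = (Q' t).1)
    (hmeet : ∀ t u, RunsMeet (P t) (Q t) (σ t) (P u) (Q u) (σ u) ↔
      RunsMeet (P' t) (Q' t) (σ t) (P' u) (Q' u) (σ u))
    (hord : ∀ t u v, σ t * intercept (P u) (σ u) < σ t * intercept (P v) (σ v) ↔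
      σ t * intercept (P' u) (σ u) < σ t * intercept (P' v) (σ v)) :
    CombEquiv I J := by
  choose τ hτ hτD using hI
  choose ρ hρ hρD using hJ
  have run_eq : ∀ t u, IsEndpoints I (P t) (Q t) (σ t) → IsEndpoints I (P u) (Q u) (σ u) →
      (diagRun (P t) (Q t) (σ t) = diagRun (P u) (Q u) (σ u) ↔
        diagRun (P' t) (Q' t) (σ t) = diagRun (P' u) (Q' u) (σ u)) := by
    intro t u ht hu
    rw [ht.diagRun_eq_iff hu, ((hIJ t).1 ht).diagRun_eq_iff ((hIJ u).1 hu), hP, hQ]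
  -- A diagonal is sent to the run with the same index. By `run_eq` the choice of index does not
  -- matter, which gives both inverse laws.
  let e : {D // IsDiagonal I D} ≃ {D // IsDiagonal J D} :=
    { toFun := fun D => ⟨diagRun (P' (τ D.1 D.2)) (Q' (τ D.1 D.2)) (σ (τ D.1 D.2)),
        ((hIJ _).1 (hτ D.1 D.2)).isDiagonal (hσ _)⟩
      invFun := fun D => ⟨diagRun (P (ρ D.1 D.2)) (Q (ρ D.1 D.2)) (σ (ρ D.1 D.2)),
        ((hIJ _).2 (hρ D.1 D.2)).isDiagonal (hσ _)⟩
      left_inv := by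
        rintro ⟨D, hD⟩
        apply Subtype.ext
        refine Eq.trans ?_ (hτD D hD).symm
        refine (run_eq _ _ ((hIJ _).2 (hρ _ _)) (hτ _ _)).2 ?_
        exact (hρD _ _).symm
      right_inv := by
        rintro ⟨D, hD⟩
        apply Subtype.ext
        refine Eq.trans ?_ (hρD D hD).symm
        refine (run_eq _ _ (hτ _ _) ((hIJ _).2 (hρ _ _))).1 ?_
        exact (hτD _ _).symm }
  refine ⟨e, ?_, ?_, ?_⟩
  · rintro ⟨D, hD⟩ s
    have h1 := hasSlope_diagRun_iff (hτ D hD) s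
    rw [← hτD D hD] at h1
    rw [h1, hPQ]
    exact (hasSlope_diagRun_iff ((hIJ _).1 (hτ D hD)) s).symm
  · rintro ⟨D, hD⟩ ⟨E, hE⟩
    have hd := hτ D hD
    have he := hτ E hE
    have hd' := (hIJ _).1 hd
    have he' := (hIJ _).1 he
    have h1 := realSegment_inter_nonempty_iff (hσ _) (hσ _) hd.le hd.slope he.le he.slope
    rw [← hτD D hD, ← hτD E hE] at h1
    rw [h1, hmeet]
    exact (realSegment_inter_nonempty_iff (hσ _) (hσ _) hd'.le hd'.slope he'.le he'.slope).symm
  · rintro D E F hDE hDF - p hp q hq p' hp' q' hq'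
    have hDE' : (e D).1 ≠ (e E).1 := fun h => hDE (e.injective (Subtype.ext h))
    have hDF' : (e D).1 ≠ (e F).1 := fun h => hDF (e.injective (Subtype.ext h))
    have hDE0 : D.1 ≠ E.1 := fun h => hDE (Subtype.ext h)
    have hDF0 : D.1 ≠ F.1 := fun h => hDF (Subtype.ext h)
    obtain ⟨D, hD⟩ := D
    obtain ⟨E, hE⟩ := E
    obtain ⟨F, hF⟩ := F
    simp only at hp hq hDE0 hDF0
    have hd := hτ D hD
    have he := hτ E hE
    have hf := hτ F hF
    rw [hτD D hD, hτD E hE] at hp hDE0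
    rw [hτD D hD, hτD F hF] at hq hDF0
    have k1 := two_mul_fst_of_mem_inter (hσ _) (hσ _) hd he hDE0 hp
    have k2 := two_mul_fst_of_mem_inter (hσ _) (hσ _) hd hf hDF0 hq
    have k3 := two_mul_fst_of_mem_inter (hσ _) (hσ _) ((hIJ _).1 hd) ((hIJ _).1 he) hDE' hp'
    have k4 := two_mul_fst_of_mem_inter (hσ _) (hσ _) ((hIJ _).1 hd) ((hIJ _).1 hf) hDF' hq'
    -- Twice the abscissas are σ(c_E - c_D) and σ(c_F - c_D), with σ the slope of D; the term of D
    -- cancels.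
    have l1 : p.1 < q.1 ↔ σ (τ D hD) * intercept (P (τ E hE)) (σ (τ E hE)) <
        σ (τ D hD) * intercept (P (τ F hF)) (σ (τ F hF)) := by
      rw [← @Int.cast_lt ℝ]
      push_cast at k1 k2 ⊢
      constructor <;> intro h <;> linarith
    have l2 : p'.1 < q'.1 ↔ σ (τ D hD) * intercept (P' (τ E hE)) (σ (τ E hE)) <
        σ (τ D hD) * intercept (P' (τ F hF)) (σ (τ F hF)) := by
      rw [← @Int.cast_lt ℝ]
      push_cast at k3 k4 ⊢
      constructor <;> intro h <;> linarith
    rw [l1, l2, hord]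

end DiagonalGeometry

/-! ### Piecewise affine functions and predicates with uniformly few changes -/

section UniformlyTame

open Filter

/-- The filter of the sets of pairs `(θ, x)` whose complement has a bounded number of points
over every `θ`. -/
def unifCofinite (Θ : Type*) : Filter (Θ × ℤ) where
  sets := {s | ∃ N : ℕ, ∀ θ, ∃ S : Finset ℤ, S.card ≤ N ∧ ∀ x ∉ S, (θ, x) ∈ s}
  univ_sets := ⟨0, fun _ => ⟨∅, by simp⟩⟩
  sets_of_superset := by
    rintro s t ⟨N, hN⟩ hst
    refine ⟨N, fun θ => ?_⟩
    obtain ⟨S, hS, h⟩ := hN θ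
    exact ⟨S, hS, fun x hx => hst (h x hx)⟩
  inter_sets := by
    rintro s t ⟨N, hN⟩ ⟨M, hM⟩
    refine ⟨N + M, fun θ => ?_⟩
    obtain ⟨S, hS, h⟩ := hN θ
    obtain ⟨T, hT, h'⟩ := hM θ
    refine ⟨S ∪ T, (Finset.card_union_le _ _).trans (add_le_add hS hT), fun x hx => ?_⟩
    rw [Finset.notMem_union] at hx
    exact ⟨h x hx.1, h' x hx.2⟩

variable {Θ : Type*}

lemma eventually_unifCofinite {Q : Θ → ℤ → Prop} :
    (∀ᶠ p in unifCofinite Θ, Q p.1 p.2) ↔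
      ∃ N : ℕ, ∀ θ, ∃ S : Finset ℤ, S.card ≤ N ∧ ∀ x ∉ S, Q θ x := Iff.rfl

lemma eventually_succ {Q : Θ → ℤ → Prop} (h : ∀ᶠ p in unifCofinite Θ, Q p.1 p.2) :
    ∀ᶠ p in unifCofinite Θ, Q p.1 (p.2 + 1) := by
  rw [eventually_unifCofinite] at h
  rw [eventually_unifCofinite (Q := fun θ x => Q θ (x + 1))]
  obtain ⟨N, hN⟩ := h
  refine ⟨N, fun θ => ?_⟩
  obtain ⟨S, hS, h⟩ := hN θ
  refine ⟨S.image (· - 1), Finset.card_image_le.trans hS, fun x hx => h _ fun hmem => hx ?_⟩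
  exact Finset.mem_image.2 ⟨_, hmem, by simp⟩

/-- A predicate in an integer `x` and a parameter whose truth value changes a bounded number of
times as `x` varies. -/
def Tame (P : Θ → ℤ → Prop) : Prop :=
  ∀ᶠ p in unifCofinite Θ, P p.1 p.2 ↔ P p.1 (p.2 + 1)

/-- A function of an integer `x` and a parameter that is piecewise affine in `x` with a bounded
number of pieces. -/
def PiecewiseAffine (F : Θ → ℤ → ℤ) : Prop :=
  ∀ᶠ p in unifCofinite Θ, F p.1 (p.2 + 2) - 2 * F p.1 (p.2 + 1) + F p.1 p.2 = 0

namespace Tame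

variable {P Q : Θ → ℤ → Prop}

lemma not (h : Tame P) : Tame fun θ x => ¬ P θ x := by
  filter_upwards [h] with p hp using not_congr hp

lemma and (h : Tame P) (h' : Tame Q) : Tame fun θ x => P θ x ∧ Q θ x := by
  filter_upwards [h, h'] with p hp hq using and_congr hp hq

lemma imp (h : Tame P) (h' : Tame Q) : Tame fun θ x => P θ x → Q θ x := by
  filter_upwards [h, h'] with p hp hq using imp_congr hp hq

lemma congr (h : Tame P) (hPQ : ∀ θ x, P θ x ↔ Q θ x) : Tame Q := by
  filter_upwards [h] with p hp
  rw [← hPQ, ← hPQ, hp]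

lemma const (R : Prop) : Tame fun (_ : Θ) _ => R := Eventually.of_forall fun _ => Iff.rfl

lemma forall_finite {ι : Type*} [Finite ι] {P : ι → Θ → ℤ → Prop} (h : ∀ i, Tame (P i)) :
    Tame fun θ x => ∀ i, P i θ x := by
  filter_upwards [eventually_all.2 h] with p hp using forall_congr' hp

end Tame

lemma affine_of_second_diff {F : ℤ → ℤ} {a : ℤ} {n : ℕ}
    (h : ∀ x, a ≤ x → x < a + n → F (x + 2) - 2 * F (x + 1) + F x = 0) :
    ∀ k : ℕ, k ≤ n + 1 → F (a + k) = F a + k * (F (a + 1) - F a) := by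
  intro k
  induction k using Nat.strong_induction_on with
  | _ k ih =>
    intro hk
    match k, ih, hk with
    | 0, _, _ => simp
    | 1, _, _ => simp
    | k + 2, ih, hk =>
      have h1 := ih (k + 1) (by omega) (by omega)
      have h0 := ih k (by omega) (by omega)
      have := h (a + k) (by omega) (by omega)
      push_cast at h1 h0 ⊢
      rw [show a + k + 1 = a + (k + 1) by ring, show a + k + 2 = a + (k + 2) by ring] at this
      linear_combination this + 2 * h1 - h0

/-- Send a sign change x to the least element of `S` that is at least x, or to ⊤. If x < y had the
same image, no element of `S` would lie in [x, y), so F would be affine on [x, y + 1] and change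
sign twice. Thus the map is injective, with at most `S.card + 1` values. -/
lemma card_sign_changes_le {F : ℤ → ℤ} {S : Finset ℤ}
    (h : ∀ x ∉ S, F (x + 2) - 2 * F (x + 1) + F x = 0) :
    ∃ T : Finset ℤ, T.card ≤ S.card + 1 ∧ ∀ x ∉ T, (0 ≤ F x ↔ 0 ≤ F (x + 1)) := by
  classical
  let Z : Set ℤ := {x | ¬ (0 ≤ F x ↔ 0 ≤ F (x + 1))}
  let φ : ℤ → WithTop ℤ := fun x => (S.filter (x ≤ ·)).min
  have hφ : ∀ x, φ x ∈ insert ⊤ (S.image ((↑) : ℤ → WithTop ℤ)) := by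
    intro x
    rcases hm : (S.filter (x ≤ ·)).min with _ | m
    · simp only [φ, hm]
      exact Finset.mem_insert_self _ _
    · simp only [φ, hm]
      refine Finset.mem_insert_of_mem (Finset.mem_image.2 ⟨m, ?_, rfl⟩)
      exact Finset.mem_of_mem_filter _ (Finset.mem_of_min hm)
  have hinj : Set.InjOn φ Z := by
    have key : ∀ x ∈ Z, ∀ y ∈ Z, x < y → φ x ≠ φ y := by
      intro x hx y hy hxy he
      have hS : ∀ z, x ≤ z → z < y → z ∉ S := by
        intro z hz hz' hzS
        have h1 : φ x ≤ z := Finset.min_le (Finset.mem_filter.2 ⟨hzS, hz⟩)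
        rw [he] at h1
        have h2 : (y : WithTop ℤ) ≤ φ y := by
          refine Finset.le_min fun w hw => ?_
          exact WithTop.coe_le_coe.2 (Finset.mem_filter.1 hw).2
        have := WithTop.coe_le_coe.1 (h2.trans h1)
        omega
      obtain ⟨n, rfl⟩ : ∃ n : ℕ, y = x + n := ⟨(y - x).toNat, by omega⟩
      have haff := affine_of_second_diff (F := F) (a := x) (n := n)
        fun z hz hz' => h z (hS z hz hz')
      have e1 := haff n (by omega)
      have e2 := haff (n + 1) le_rfl
      push_cast at e2
      rw [← add_assoc] at e2
      have hx' : ¬ (0 ≤ F x ↔ 0 ≤ F (x + 1)) := hx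
      have hy' : ¬ (0 ≤ F (x + n) ↔ 0 ≤ F (x + n + 1)) := hy
      rw [e1, e2] at hy'
      have hn : (1 : ℤ) ≤ n := by omega
      set d := F (x + 1) - F x with hd
      have hx1 : F (x + 1) = F x + d := by omega
      rw [hx1] at hx'
      generalize F x = a at *
      rcases le_or_gt 0 a with h0 | h0
      · have hd0 : a + d < 0 := by
          by_contra hc
          exact hx' ⟨fun _ => by omega, fun _ => h0⟩
        have : a + n * d < 0 := by nlinarith
        exact hy' ⟨fun _ => by omega, fun _ => by nlinarith⟩
      · have hd0 : 0 ≤ a + d := by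
          by_contra hc
          exact hx' ⟨fun _ => by omega, fun _ => by omega⟩
        have : 0 ≤ a + n * d := by nlinarith
        exact hy' ⟨fun _ => by nlinarith, fun _ => this⟩
    intro x hx y hy he
    rcases lt_trichotomy x y with hlt | heq | hlt
    · exact absurd he (key x hx y hy hlt)
    · exact heq
    · exact absurd he.symm (key y hy x hx hlt)
  have hfin : Z.Finite := Set.Finite.of_injOn (fun x _ => hφ x) hinj (Finset.finite_toSet _)
  refine ⟨hfin.toFinset, ?_, fun x hx => ?_⟩
  · calc hfin.toFinset.card ≤ (insert ⊤ (S.image ((↑) : ℤ → WithTop ℤ))).card :=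
          Finset.card_le_card_of_injOn φ (fun x _ => hφ x) (by simpa using hinj)
      _ ≤ (S.image ((↑) : ℤ → WithTop ℤ)).card + 1 := Finset.card_insert_le _ _
      _ ≤ S.card + 1 := by
          gcongr
          exact Finset.card_image_le
  · rw [Set.Finite.mem_toFinset] at hx
    exact not_not.1 hx

namespace PiecewiseAffine

variable {F H : Θ → ℤ → ℤ}

lemma nonneg (h : PiecewiseAffine F) : Tame fun θ x => 0 ≤ F θ x := by
  obtain ⟨N, hN⟩ := h
  refine ⟨N + 1, fun θ => ?_⟩
  obtain ⟨S, hS, h⟩ := hN θ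
  obtain ⟨T, hT, h'⟩ := card_sign_changes_le (F := F θ) h
  exact ⟨T, hT.trans (by omega), h'⟩

lemma const (c : Θ → ℤ) : PiecewiseAffine fun θ _ => c θ :=
  Eventually.of_forall fun _ => by ring

lemma id : PiecewiseAffine fun (_ : Θ) x => x :=
  Eventually.of_forall fun _ => by ring

lemma add (h : PiecewiseAffine F) (h' : PiecewiseAffine H) :
    PiecewiseAffine fun θ x => F θ x + H θ x := by
  filter_upwards [h, h'] with p hp hq
  linear_combination hp + hq

lemma const_mul (c : ℤ) (h : PiecewiseAffine F) : PiecewiseAffine fun θ x => c * F θ x := by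
  filter_upwards [h] with p hp
  linear_combination c * hp

lemma neg (h : PiecewiseAffine F) : PiecewiseAffine fun θ x => - F θ x := by
  simpa using h.const_mul (-1)

lemma sub (h : PiecewiseAffine F) (h' : PiecewiseAffine H) :
    PiecewiseAffine fun θ x => F θ x - H θ x := by
  simpa [sub_eq_add_neg] using h.add h'.neg

lemma le (h : PiecewiseAffine F) (h' : PiecewiseAffine H) :
    Tame fun θ x => F θ x ≤ H θ x :=
  (h'.sub h).nonneg.congr fun _ _ => sub_nonneg

lemma lt (h : PiecewiseAffine F) (h' : PiecewiseAffine H) :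
    Tame fun θ x => F θ x < H θ x :=
  (h'.le h).not.congr fun _ _ => not_le

lemma eq (h : PiecewiseAffine F) (h' : PiecewiseAffine H) :
    Tame fun θ x => F θ x = H θ x :=
  ((h.le h').and (h'.le h)).congr fun _ _ => le_antisymm_iff.symm

lemma ite {P : Θ → ℤ → Prop} [∀ θ x, Decidable (P θ x)] (hP : Tame P) (h : PiecewiseAffine F)
    (h' : PiecewiseAffine H) : PiecewiseAffine fun θ x => if P θ x then F θ x else H θ x := by
  -- A second difference involves three consecutive points; outside the exceptions the condition has
  -- the same value at all of them.
  filter_upwards [hP, eventually_succ (Q := fun θ x => P θ x ↔ P θ (x + 1)) hP, h, h']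
    with p hp hp' hf hh
  rw [add_assoc] at hp'
  norm_num at hp'
  by_cases h0 : P p.1 p.2
  · have h1 := hp.1 h0
    have h2 := hp'.1 h1
    simpa only [h0, h1, h2, if_true] using hf
  · have h1 := mt hp.2 h0
    have h2 := mt hp'.2 h1
    simpa only [h0, h1, h2, if_false] using hh

lemma min (h : PiecewiseAffine F) (h' : PiecewiseAffine H) :
    PiecewiseAffine fun θ x => min (F θ x) (H θ x) := by
  simpa only [min_def] using ite (h.le h') h h'

lemma abs (h : PiecewiseAffine F) : PiecewiseAffine fun θ x => |F θ x| := by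
  have := (ite h.nonneg h h.neg)
  convert this using 3 with θ x
  split_ifs with h0
  · exact abs_of_nonneg h0
  · exact abs_of_neg (by omega)

/-- Where F is affine with even slope its parity is constant, so rounding down does not disturb the
affine form. -/
lemma half (h : PiecewiseAffine F)
    (h2 : ∀ᶠ p in unifCofinite Θ, (F p.1 (p.2 + 1) - F p.1 p.2) % 2 = 0) :
    PiecewiseAffine fun θ x => F θ x / 2 := by
  filter_upwards [h, h2] with p hp hq
  omega

end PiecewiseAffine

end UniformlyTame

/-! ### Level sets of functions with finitely many break points -/

section LevelPlots

open Filter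

/-- The integer points of `[0, ℓ] × [0, m]` at which `f` of the first coordinate equals `g` of
the second. -/
def levelPlot (ℓ m : ℤ) (f g : ℤ → ℤ) : Set (ℤ × ℤ) :=
  {q | (0 ≤ q.1 ∧ q.1 ≤ ℓ) ∧ (0 ≤ q.2 ∧ q.2 ≤ m) ∧ f q.1 = g q.2}

/-- Between the nearest zeros on either side of a point where h ≠ 0 there is no element of `Z`, so h
is affine there with two zeros, hence zero. -/
lemma forall_eq_zero_of_breaks {h : ℤ → ℤ} {Z : Set ℤ} {lo hi : ℤ}
    (hZ : ∀ i, lo < i → i < hi → i ∉ Z → h (i + 1) - 2 * h i + h (i - 1) = 0)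
    (hlo : h lo = 0) (hhi : h hi = 0) (h0 : ∀ z ∈ Z, lo ≤ z → z ≤ hi → h z = 0) :
    ∀ i, lo ≤ i → i ≤ hi → h i = 0 := by
  intro i hi1 hi2
  by_contra hne
  obtain ⟨a, ⟨ha1, ha2, ha3⟩, ha4⟩ := Int.exists_greatest_of_bdd
    (P := fun z => lo ≤ z ∧ z ≤ i ∧ h z = 0) ⟨i, fun z hz => hz.2.1⟩ ⟨lo, le_rfl, hi1, hlo⟩
  obtain ⟨b, ⟨hb1, hb2, hb3⟩, hb4⟩ := Int.exists_least_of_bdd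
    (P := fun z => i ≤ z ∧ z ≤ hi ∧ h z = 0) ⟨i, fun z hz => hz.1⟩ ⟨hi, hi2, le_rfl, hhi⟩
  have hai : a ≠ i := fun e => hne (e ▸ ha3)
  have hbi : b ≠ i := fun e => hne (e ▸ hb3)
  have hnz : ∀ z, a < z → z < b → h z ≠ 0 := by
    intro z hz1 hz2 hz
    rcases le_total z i with hzi | hzi
    · have := ha4 z ⟨by omega, hzi, hz⟩
      omega
    · have := hb4 z ⟨hzi, by omega, hz⟩
      omega
  obtain ⟨n, hn⟩ : ∃ n : ℕ, b = a + (n + 1 : ℕ) := ⟨(b - a - 1).toNat, by omega⟩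
  have haff := affine_of_second_diff (F := h) (a := a) (n := n) (fun x hx hx' => by
    have := hZ (x + 1) (by omega) (by omega)
      (fun hm => hnz _ (by omega) (by omega) (h0 _ hm (by omega) (by omega)))
    rw [add_sub_cancel_right] at this
    convert this using 4
    ring) (n + 1) le_rfl
  rw [← hn, ha3, hb3] at haff
  have h1 : h (a + 1) ≠ 0 := hnz _ (by omega) (by omega)
  have hn' : ((n + 1 : ℕ) : ℤ) ≠ 0 := by omega
  apply mul_ne_zero hn' h1
  linarith

variable {Θ ι κ : Type*}

/-- The functions `f θ x` of an integer have the finitely many break points `b k θ x`: they have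
slope `1` or `-1` around all other points. The break points include the ends of `[0, ℓ θ]`, they
are piecewise affine in `x`, and `f` preserves piecewise affine functions. -/
structure HasBreaks (ℓ : Θ → ℤ) (f : Θ → ℤ → ℤ → ℤ) (b : ι → Θ → ℤ → ℤ) : Prop where
  comp : ∀ y, PiecewiseAffine y → PiecewiseAffine fun θ x => f θ x (y θ x)
  breaks : ∀ k, PiecewiseAffine (b k)
  zero : ∃ k, ∀ θ x, b k θ x = 0
  length : ∃ k, ∀ θ x, b k θ x = ℓ θ
  slope : ∀ θ x i, (∀ k, i ≠ b k θ x) →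
    ∃ τ : ℤ, (τ = 1 ∨ τ = -1) ∧ f θ x (i + 1) = f θ x i + τ ∧ f θ x i = f θ x (i - 1) + τ

variable {ℓ m : Θ → ℤ} {f g : Θ → ℤ → ℤ → ℤ} {b : ι → Θ → ℤ → ℤ} {c : κ → Θ → ℤ → ℤ}

/-- The value at a point `j` determines it up to a bounded number of choices. -/
lemma HasBreaks.exists_eq (hg : HasBreaks m g c) (θ : Θ) (x : ℤ) {j : ℤ} (hj : 0 ≤ j) :
    ∃ (l : κ) (τ : SignType), j = c l θ x + τ * (g θ x j - g θ x (c l θ x)) := by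
  -- Going up from the break point 0, the slope τ stays constant after the last break point passed.
  -- Since τ = ±1, the resulting equation can be solved for j; the sign 0 covers break points
  -- themselves.
  have key : ∀ j : ℕ, (∃ l, (j : ℤ) = c l θ x) ∨ ∃ (l : κ) (τ : ℤ), (τ = 1 ∨ τ = -1) ∧
      g θ x j = g θ x (c l θ x) + τ * (j - c l θ x) ∧ g θ x (j + 1) = g θ x j + τ := by
    intro j
    induction j with
    | zero =>
      obtain ⟨l, hl⟩ := hg.zero
      exact Or.inl ⟨l, by simp [hl]⟩
    | succ j ih =>
      by_cases hb : ∃ l, ((j + 1 : ℕ) : ℤ) = c l θ x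
      · exact Or.inl hb
      · right
        push Not at hb
        obtain ⟨τ, hτ, h1, h2⟩ := hg.slope θ x _ hb
        push_cast at h1 h2 ⊢
        rw [add_sub_cancel_right] at h2
        rcases ih with ⟨l, hl⟩ | ⟨l, τ', hτ', h3, h4⟩
        · refine ⟨l, τ, hτ, ?_, h1⟩
          rw [h2, ← hl]
          ring
        · refine ⟨l, τ, hτ, ?_, h1⟩
          have : τ' = τ := by omega
          subst this
          rw [h4, h3]
          ring
  obtain ⟨j, rfl⟩ := Int.eq_ofNat_of_zero_le hj
  rcases key j with ⟨l, hl⟩ | ⟨l, τ, rfl | rfl, h, -⟩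
  · exact ⟨l, 0, by simp [hl]⟩
  · exact ⟨l, 1, by simp [h]⟩
  · exact ⟨l, -1, by simp [h]⟩

/-- The points of a level plot in the row or column of a break point, with some others. -/
def cornerCandidate (f g : Θ → ℤ → ℤ → ℤ) (b : ι → Θ → ℤ → ℤ) (c : κ → Θ → ℤ → ℤ) :
    (ι × κ × SignType) ⊕ (ι × κ × SignType) → Θ → ℤ → ℤ × ℤ
  | .inl (k, l, τ), θ, x =>
    (b k θ x, c l θ x + τ * (f θ x (b k θ x) - g θ x (c l θ x)))
  | .inr (k, l, τ), θ, x =>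
    (b k θ x + τ * (g θ x (c l θ x) - f θ x (b k θ x)), c l θ x)

lemma piecewiseAffine_cornerCandidate (hf : HasBreaks ℓ f b) (hg : HasBreaks m g c)
    (t : (ι × κ × SignType) ⊕ (ι × κ × SignType)) :
    PiecewiseAffine (fun θ x => (cornerCandidate f g b c t θ x).1) ∧
      PiecewiseAffine (fun θ x => (cornerCandidate f g b c t θ x).2) := by
  rcases t with ⟨k, l, τ⟩ | ⟨k, l, τ⟩
  · exact ⟨hf.breaks k, (hg.breaks l).add
      (((hf.comp _ (hf.breaks k)).sub (hg.comp _ (hg.breaks l))).const_mul _)⟩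
  · exact ⟨(hf.breaks k).add
      (((hg.comp _ (hg.breaks l)).sub (hf.comp _ (hf.breaks k))).const_mul _), hg.breaks l⟩

/-- One coordinate is a break point, so the common value of f and g is known there, and
`HasBreaks.exists_eq` recovers the other coordinate. -/
lemma exists_eq_cornerCandidate (hf : HasBreaks ℓ f b) (hg : HasBreaks m g c) {θ : Θ} {x : ℤ}
    {p : ℤ × ℤ} (hp : p ∈ levelPlot (ℓ θ) (m θ) (f θ x) (g θ x))
    (h : (∃ k, p.1 = b k θ x) ∨ ∃ l, p.2 = c l θ x) :
    ∃ t, p = cornerCandidate f g b c t θ x := by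
  obtain ⟨⟨h1, -⟩, ⟨h2, -⟩, he⟩ := hp
  rcases h with ⟨k, hk⟩ | ⟨l, hl⟩
  · obtain ⟨l, τ, hl⟩ := hg.exists_eq θ x h2
    refine ⟨.inl (k, l, τ), Prod.ext hk ?_⟩
    rwa [← he, hk] at hl
  · obtain ⟨k, τ, hk⟩ := hf.exists_eq θ x h1
    refine ⟨.inr (k, l, τ), Prod.ext ?_ hl⟩
    rwa [he, hl] at hk

/-- The end points of a diagonal are in the row or column of a break point. -/
lemma exists_break_of_extend (hf : HasBreaks ℓ f b) (hg : HasBreaks m g c) {θ : Θ} {x : ℤ}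
    {p : ℤ × ℤ} {σ ε : ℤ} (hσ : σ = 1 ∨ σ = -1) (hε : ε = 1 ∨ ε = -1)
    (hp : p ∈ levelPlot (ℓ θ) (m θ) (f θ x) (g θ x))
    (hn : (p.1 + ε, p.2 + ε * σ) ∉ levelPlot (ℓ θ) (m θ) (f θ x) (g θ x))
    (hs : f θ x (p.1 - ε) = g θ x (p.2 - ε * σ) ∨
      (p.1 + ε, p.2 - ε * σ) ∉ levelPlot (ℓ θ) (m θ) (f θ x) (g θ x)) :
    (∃ k, p.1 = b k θ x) ∨ ∃ l, p.2 = c l θ x := by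
  by_contra! hc
  obtain ⟨hc1, hc2⟩ := hc
  obtain ⟨τ, hτ, h1, h2⟩ := hf.slope θ x _ hc1
  obtain ⟨ρ, hρ, h3, h4⟩ := hg.slope θ x _ hc2
  obtain ⟨k0, hk0⟩ := hf.zero
  obtain ⟨k1, hk1⟩ := hf.length
  obtain ⟨l0, hl0⟩ := hg.zero
  obtain ⟨l1, hl1⟩ := hg.length
  have n1 := hk0 θ x ▸ hc1 k0
  have n2 := hk1 θ x ▸ hc1 k1
  have n3 := hl0 θ x ▸ hc2 l0
  have n4 := hl1 θ x ▸ hc2 l1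
  obtain ⟨p1, p2⟩ := p
  simp only [levelPlot, Set.mem_ofPred_eq, not_and] at *
  obtain ⟨⟨a1, a2⟩, ⟨a3, a4⟩, a5⟩ := hp
  have hεσ : ε * σ = 1 ∨ ε * σ = -1 := by
    rcases hε with rfl | rfl <;> rcases hσ with rfl | rfl <;> simp
  -- The ends of both intervals are break points, so the neighbors of `p` remain in the box.
  have r1 : 0 ≤ p1 + ε ∧ p1 + ε ≤ ℓ θ := by clear * - a1 a2 n1 n2 hε; omega
  have r2 : 0 ≤ p2 + ε * σ ∧ p2 + ε * σ ≤ m θ := by clear * - a3 a4 n3 n4 hεσ; omega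
  have r3 : 0 ≤ p2 - ε * σ ∧ p2 - ε * σ ≤ m θ := by clear * - a3 a4 n3 n4 hεσ; omega
  have f1 : f θ x (p1 + ε) = f θ x p1 + ε * τ := by
    rcases hε with rfl | rfl
    · rw [h1, one_mul]
    · rw [← sub_eq_add_neg, h2]; ring
  have f2 : f θ x (p1 - ε) = f θ x p1 - ε * τ := by
    rcases hε with rfl | rfl
    · rw [h2]; ring
    · rw [sub_neg_eq_add, h1]; ring
  have g1 : g θ x (p2 + ε * σ) = g θ x p2 + ε * σ * ρ := by
    rcases hε with rfl | rfl <;> rcases hσ with rfl | rfl <;> norm_num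
    · rw [h3]
    · rw [← sub_eq_add_neg, h4]; ring
    · rw [← sub_eq_add_neg, h4]; ring
    · rw [h3]
  have g2 : g θ x (p2 - ε * σ) = g θ x p2 - ε * σ * ρ := by
    rcases hε with rfl | rfl <;> rcases hσ with rfl | rfl <;> norm_num
    · rw [h4]; ring
    · rw [h3]
    · rw [h3]
    · rw [h4]; ring
  have hn' := hn r1 r2
  rw [f1, g1, a5] at hn'
  -- Near `p` the level set continues on both sides with slope σ if τ = σρ, and with slope -σ if τ =
  -- -σρ. The first is excluded by `hn`, the second by either alternative of `hs`.
  have hne : τ ≠ σ * ρ := fun e => hn' (by rw [e]; ring)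
  have hτρ : τ = -(σ * ρ) := by
    clear hn hs hn' h1 h2 h3 h4 f1 f2 g1 g2
    rcases hσ with rfl | rfl <;> omega
  rcases hs with hs | hs
  · rw [f2, g2, a5, hτρ] at hs
    have : ε * σ * ρ = 0 := by linarith
    clear hn hn' h1 h2 h3 h4 f1 f2 g1 g2 hs
    rcases hεσ with h | h <;> rw [h] at this <;> omega
  · refine hs r1 r3 ?_
    rw [f1, g2, a5, hτρ]
    ring

/-- The indices of the two ends range over a type independent of θ and x; this is what bounds the
combinatorial complexity. -/
lemma exists_eq_diagRun_cornerCandidate (hf : HasBreaks ℓ f b) (hg : HasBreaks m g c) {θ : Θ}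
    {x : ℤ} {D : Set (ℤ × ℤ)} (hD : IsDiagonal (levelPlot (ℓ θ) (m θ) (f θ x) (g θ x)) D) :
    ∃ (σ : ℤˣ) (s t : (ι × κ × SignType) ⊕ (ι × κ × SignType)),
      IsEndpoints (levelPlot (ℓ θ) (m θ) (f θ x) (g θ x)) (cornerCandidate f g b c s θ x)
        (cornerCandidate f g b c t θ x) σ ∧
      D = diagRun (cornerCandidate f g b c s θ x) (cornerCandidate f g b c t θ x) σ := by
  obtain ⟨p, q, σ, hσ, h, rfl⟩ := hD.exists_isEndpoints
  have hp := h.diagRun_subset h.left_mem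
  have hq := h.diagRun_subset h.right_mem
  have hle := h.le
  have hslope := h.slope
  obtain ⟨s, rfl⟩ := exists_eq_cornerCandidate hf hg hp <| by
    refine exists_break_of_extend hf hg hσ (ε := -1) (Or.inr rfl) hp ?_ ?_
    · convert h.left using 2
      simp [sub_eq_add_neg]
    · rcases eq_or_lt_of_le hle with heq | hlt
      · right
        convert (h.single heq).1 using 2
        simp [sub_eq_add_neg]
      · left
        convert (h.subset (p.1 + 1) (by omega) (by omega)).2.2 using 2
        · ring
        · simp
  obtain ⟨t, rfl⟩ := exists_eq_cornerCandidate hf hg hq <| by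
    refine exists_break_of_extend hf hg hσ (ε := 1) (Or.inl rfl) hq ?_ ?_
    · convert h.right using 2
      simp
    · rcases eq_or_lt_of_le hle with heq | hlt
      · right
        rw [heq, sub_self, mul_zero] at hslope
        convert (h.single heq).2 using 2
        simp [heq, sub_eq_zero.1 hslope]
      · left
        convert (h.subset (q.1 - 1) (by omega) (by omega)).2.2 using 2
        simp only
        linear_combination hslope
  rcases hσ with rfl | rfl
  · exact ⟨1, s, t, by simpa using h, by simp⟩
  · exact ⟨-1, s, t, by simpa using h, by simp⟩

lemma tame_mem_levelPlot (hf : HasBreaks ℓ f b) (hg : HasBreaks m g c) {y z : Θ → ℤ → ℤ}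
    (hy : PiecewiseAffine y) (hz : PiecewiseAffine z) :
    Tame fun θ x => (y θ x, z θ x) ∈ levelPlot (ℓ θ) (m θ) (f θ x) (g θ x) :=
  (((PiecewiseAffine.const fun _ => 0).le hy).and (hy.le (.const ℓ))).and
    ((((PiecewiseAffine.const fun _ => 0).le hz).and (hz.le (.const m))).and
      ((hf.comp y hy).eq (hg.comp z hz)))

/-- Along the run the difference of f and g has zero second difference except at break points of f
and pulled-back break points of g. So the unboundedly many conditions on a run reduce to one test at
each end and at each break point. -/
lemma forall_mem_levelPlot_iff (hf : HasBreaks ℓ f b) (hg : HasBreaks m g c) (θ : Θ) (x : ℤ)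
    (p : ℤ × ℤ) (r : ℤ) {σ : ℤ} (hσ : σ = 1 ∨ σ = -1) (hle : p.1 ≤ r) :
    (∀ i, p.1 ≤ i → i ≤ r →
      (i, p.2 + σ * (i - p.1)) ∈ levelPlot (ℓ θ) (m θ) (f θ x) (g θ x)) ↔
    p ∈ levelPlot (ℓ θ) (m θ) (f θ x) (g θ x) ∧
    (r, p.2 + σ * (r - p.1)) ∈ levelPlot (ℓ θ) (m θ) (f θ x) (g θ x) ∧
    (∀ k, p.1 ≤ b k θ x → b k θ x ≤ r →
      f θ x (b k θ x) = g θ x (p.2 + σ * (b k θ x - p.1))) ∧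
    (∀ l, p.1 ≤ p.1 + σ * (c l θ x - p.2) → p.1 + σ * (c l θ x - p.2) ≤ r →
      f θ x (p.1 + σ * (c l θ x - p.2)) = g θ x (c l θ x)) := by
  have hσσ : ∀ a, σ * (σ * a) = a := by
    intro a
    rcases hσ with rfl | rfl <;> ring
  constructor
  · intro h
    refine ⟨?_, h r hle le_rfl, fun k h1 h2 => (h _ h1 h2).2.2, fun l h1 h2 => ?_⟩
    · simpa using h p.1 le_rfl hle
    · have := (h _ h1 h2).2.2
      simpa [hσσ] using this
  · rintro ⟨hp, hr, hk, hl⟩ i hi1 hi2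
    have hz := forall_eq_zero_of_breaks (h := fun i => f θ x i - g θ x (p.2 + σ * (i - p.1)))
      (Z := Set.range (fun k => b k θ x) ∪ Set.range fun l => p.1 + σ * (c l θ x - p.2))
      (lo := p.1) (hi := r) ?_ ?_ ?_ ?_ i hi1 hi2
    · obtain ⟨⟨a1, a2⟩, ⟨a3, a4⟩, -⟩ := hp
      obtain ⟨⟨b1, b2⟩, ⟨b3, b4⟩, -⟩ := hr
      refine ⟨⟨?_, ?_⟩, ⟨?_, ?_⟩, sub_eq_zero.1 hz⟩ <;> simp only at * <;>
        rcases hσ with rfl | rfl <;> omega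
    · intro i _ _ hiZ
      simp only [Set.mem_union, Set.mem_range, not_or, not_exists] at hiZ
      obtain ⟨τ, -, h1, h2⟩ := hf.slope θ x i fun k e => hiZ.1 k e.symm
      obtain ⟨ρ, -, h3, h4⟩ := hg.slope θ x (p.2 + σ * (i - p.1)) fun l e => hiZ.2 l (by
        rw [← e, add_sub_cancel_left, hσσ]
        ring)
      rw [h1]
      have h5 : g θ x (p.2 + σ * (i + 1 - p.1)) + g θ x (p.2 + σ * (i - 1 - p.1)) =
          2 * g θ x (p.2 + σ * (i - p.1)) := by
        rcases hσ with rfl | rfl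
        · rw [show p.2 + 1 * (i + 1 - p.1) = p.2 + 1 * (i - p.1) + 1 by ring,
            show p.2 + 1 * (i - 1 - p.1) = p.2 + 1 * (i - p.1) - 1 by ring]
          linarith
        · rw [show p.2 + -1 * (i + 1 - p.1) = p.2 + -1 * (i - p.1) - 1 by ring,
            show p.2 + -1 * (i - 1 - p.1) = p.2 + -1 * (i - p.1) + 1 by ring]
          linarith
      linarith
    · simpa using sub_eq_zero.2 hp.2.2
    · exact sub_eq_zero.2 hr.2.2
    · rintro z (⟨k, rfl⟩ | ⟨l, rfl⟩) h1 h2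
      · exact sub_eq_zero.2 (hk k h1 h2)
      · have := hl l h1 h2
        simp only [add_sub_cancel_left, hσσ, add_sub_cancel]
        exact sub_eq_zero.2 this

lemma tame_isEndpoints [Finite ι] [Finite κ] (hf : HasBreaks ℓ f b) (hg : HasBreaks m g c)
    {P Q : Θ → ℤ → ℤ × ℤ} {σ : ℤ} (hσ : σ = 1 ∨ σ = -1)
    (hP1 : PiecewiseAffine fun θ x => (P θ x).1) (hP2 : PiecewiseAffine fun θ x => (P θ x).2)
    (hQ1 : PiecewiseAffine fun θ x => (Q θ x).1) (hQ2 : PiecewiseAffine fun θ x => (Q θ x).2) :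
    Tame fun θ x =>
      IsEndpoints (levelPlot (ℓ θ) (m θ) (f θ x) (g θ x)) (P θ x) (Q θ x) σ := by
  have one := PiecewiseAffine.const fun _ : Θ => (1 : ℤ)
  have sig := PiecewiseAffine.const fun _ : Θ => σ
  have H1 := hP1.le hQ1
  have H2 := (hQ2.sub hP2).eq ((hQ1.sub hP1).const_mul σ)
  have H3 := tame_mem_levelPlot hf hg hP1 hP2
  have H4 := tame_mem_levelPlot hf hg hQ1 (hP2.add ((hQ1.sub hP1).const_mul σ))
  have H5 : Tame fun θ x => ∀ k, (P θ x).1 ≤ b k θ x → b k θ x ≤ (Q θ x).1 →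
      f θ x (b k θ x) = g θ x ((P θ x).2 + σ * (b k θ x - (P θ x).1)) :=
    Tame.forall_finite fun k => (hP1.le (hf.breaks k)).imp <| ((hf.breaks k).le hQ1).imp <|
      (hf.comp _ (hf.breaks k)).eq (hg.comp _ (hP2.add (((hf.breaks k).sub hP1).const_mul σ)))
  have H6 : Tame fun θ x => ∀ l, (P θ x).1 ≤ (P θ x).1 + σ * (c l θ x - (P θ x).2) →
      (P θ x).1 + σ * (c l θ x - (P θ x).2) ≤ (Q θ x).1 →
      f θ x ((P θ x).1 + σ * (c l θ x - (P θ x).2)) = g θ x (c l θ x) :=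
    Tame.forall_finite fun l => by
      have := hP1.add (((hg.breaks l).sub hP2).const_mul σ)
      exact (hP1.le this).imp <| (this.le hQ1).imp <|
        (hf.comp _ this).eq (hg.comp _ (hg.breaks l))
  have H7 := (tame_mem_levelPlot hf hg (hP1.sub one) (hP2.sub sig)).not
  have H8 := (tame_mem_levelPlot hf hg (hQ1.add one) (hQ2.add sig)).not
  have H9 := (hP1.eq hQ1).imp ((tame_mem_levelPlot hf hg (hP1.sub one) (hP2.add sig)).not.and
    (tame_mem_levelPlot hf hg (hP1.add one) (hP2.sub sig)).not)
  refine (H1.and <| H2.and <| (H3.and <| H4.and <| H5.and H6).and <|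
    H7.and <| H8.and H9).congr fun θ x => ?_
  constructor
  · rintro ⟨h1, h2, h3, h4, h5, h6⟩
    exact ⟨h1, h2, (forall_mem_levelPlot_iff hf hg θ x _ _ hσ h1).2 h3, h4, h5, h6⟩
  · rintro ⟨h1, h2, h3, h4, h5, h6⟩
    exact ⟨h1, h2, (forall_mem_levelPlot_iff hf hg θ x _ _ hσ h1).1 h3, h4, h5, h6⟩

/-- The combinatorial structure of a level plot changes a bounded number of times. -/
theorem eventually_combEquiv_levelPlot [Finite ι] [Finite κ] (hf : HasBreaks ℓ f b)
    (hg : HasBreaks m g c) :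
    ∀ᶠ p in unifCofinite Θ, CombEquiv
      (levelPlot (ℓ p.1) (m p.1) (f p.1 p.2) (g p.1 p.2))
      (levelPlot (ℓ p.1) (m p.1) (f p.1 (p.2 + 1)) (g p.1 (p.2 + 1))) := by
  let C := (ι × κ × SignType) ⊕ (ι × κ × SignType)
  -- An index consists of a slope and the candidates for the left and right end. Only some indices
  -- give diagonals, and which ones do is itself a tame condition.
  let T := ℤˣ × C × C
  let P : T → Θ → ℤ → ℤ × ℤ := fun t => cornerCandidate f g b c t.2.1
  let Q : T → Θ → ℤ → ℤ × ℤ := fun t => cornerCandidate f g b c t.2.2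
  let σ : T → ℤ := fun t => t.1
  have hσ : ∀ t, σ t = 1 ∨ σ t = -1 := by
    rintro ⟨s, t⟩
    rcases Int.units_eq_one_or s with rfl | rfl <;> simp [σ]
  have hP := fun t : T => piecewiseAffine_cornerCandidate hf hg t.2.1
  have hQ := fun t : T => piecewiseAffine_cornerCandidate hf hg t.2.2
  have hi : ∀ t, PiecewiseAffine fun θ x => intercept (P t θ x) (σ t) := fun t =>
    (hP t).2.sub ((hP t).1.const_mul _)
  have pair_eq : ∀ {F H : Θ → ℤ → ℤ × ℤ}, (PiecewiseAffine fun θ x => (F θ x).1) →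
      (PiecewiseAffine fun θ x => (F θ x).2) → (PiecewiseAffine fun θ x => (H θ x).1) →
      (PiecewiseAffine fun θ x => (H θ x).2) → Tame fun θ x => F θ x = H θ x :=
    fun h1 h2 h3 h4 => ((h1.eq h3).and (h2.eq h4)).congr fun _ _ => Prod.ext_iff.symm
  have T1 : ∀ t : T, Tame _ := fun t =>
    tame_isEndpoints hf hg (hσ t) (hP t).1 (hP t).2 (hQ t).1 (hQ t).2
  have T2 : ∀ tu : T × T, Tame _ := fun tu =>
    pair_eq (hP tu.1).1 (hP tu.1).2 (hP tu.2).1 (hP tu.2).2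
  have T3 : ∀ tu : T × T, Tame _ := fun tu =>
    pair_eq (hQ tu.1).1 (hQ tu.1).2 (hQ tu.2).1 (hQ tu.2).2
  have T4 : ∀ t : T, Tame _ := fun t => (hP t).1.eq (hQ t).1
  have T5 : ∀ tu : T × T, Tame fun θ x => RunsMeet (P tu.1 θ x) (Q tu.1 θ x) (σ tu.1)
      (P tu.2 θ x) (Q tu.2 θ x) (σ tu.2) := by
    rintro ⟨t, u⟩
    have hd := ((hi u).sub (hi t)).const_mul (σ t)
    exact ((Tame.const _).imp (((hi t).eq (hi u)).and
      (((hP t).1.le (hQ u).1).and ((hP u).1.le (hQ t).1)))).and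
      ((Tame.const _).imp <| (((hP t).1.const_mul 2).le hd).and <|
        (hd.le ((hQ t).1.const_mul 2)).and <| (((hP u).1.const_mul 2).le hd).and
        (hd.le ((hQ u).1.const_mul 2)))
  have T6 : ∀ tuv : T × T × T, Tame fun θ x =>
      σ tuv.1 * intercept (P tuv.2.1 θ x) (σ tuv.2.1) <
        σ tuv.1 * intercept (P tuv.2.2 θ x) (σ tuv.2.2) := fun tuv =>
    ((hi tuv.2.1).const_mul _).lt ((hi tuv.2.2).const_mul _)
  filter_upwards [eventually_all.2 T1, eventually_all.2 T2, eventually_all.2 T3,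
    eventually_all.2 T4, eventually_all.2 T5, eventually_all.2 T6] with p h1 h2 h3 h4 h5 h6
  refine combEquiv_of_matching (T := T) (σ := σ) (P := fun t => P t p.1 p.2)
    (Q := fun t => Q t p.1 p.2) (P' := fun t => P t p.1 (p.2 + 1))
    (Q' := fun t => Q t p.1 (p.2 + 1)) hσ ?_ ?_ h1 (fun t u => h2 (t, u)) (fun t u => h3 (t, u))
    h4 (fun t u => h5 (t, u)) (fun t u v => h6 (t, u, v))
  · intro D hD
    obtain ⟨s, t, u, h, he⟩ := exists_eq_diagRun_cornerCandidate hf hg hD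
    exact ⟨(s, t, u), h, he⟩
  · intro D hD
    obtain ⟨s, t, u, h, he⟩ := exists_eq_diagRun_cornerCandidate hf hg hD
    exact ⟨(s, t, u), h, he⟩

end LevelPlots

/-! ### The two shapes of the distance function -/

section DistanceProfiles

open Filter

variable {Θ : Type*}

/-- The function rises with i up to about (β + ℓ - α)/2 and then falls; the rounded value and its
successor cover both parities. With boundedly many exceptions α and β change by ±1 as x increases by
one, so the numerator has even steps and `PiecewiseAffine.half` applies. -/
lemma hasBreaks_tent (ℓ L p q p' q' : Θ → ℤ) :
    HasBreaks ℓ (fun θ x i => min (min (x + p θ) (L θ - x + q θ) + i)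
        (min (x + p' θ) (L θ - x + q' θ) + (ℓ θ - i)))
      ![fun _ _ => 0, fun θ _ => ℓ θ,
        fun θ x => (min (x + p' θ) (L θ - x + q' θ) + ℓ θ -
          min (x + p θ) (L θ - x + q θ)) / 2,
        fun θ x => (min (x + p' θ) (L θ - x + q' θ) + ℓ θ -
          min (x + p θ) (L θ - x + q θ)) / 2 + 1] := by
  have hmin : ∀ r s : Θ → ℤ, PiecewiseAffine fun θ x => min (x + r θ) (L θ - x + s θ) :=
    fun r s => (PiecewiseAffine.id.add (.const r)).min
      (((PiecewiseAffine.const L).sub .id).add (.const s))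
  have hodd : ∀ r s : Θ → ℤ, ∀ᶠ a in unifCofinite Θ,
      (min (a.2 + 1 + r a.1) (L a.1 - (a.2 + 1) + s a.1) -
        min (a.2 + r a.1) (L a.1 - a.2 + s a.1)) % 2 = 1 := by
    intro r s
    -- Only at the crossing of the two affine functions can the minimum have step 0.
    refine ⟨1, fun θ => ⟨{(L θ + s θ - r θ) / 2}, by simp, fun x hx => ?_⟩⟩
    rw [Finset.mem_singleton] at hx
    simp only [Set.mem_ofPred_eq]
    omega
  have hhalf : PiecewiseAffine fun θ x => (min (x + p' θ) (L θ - x + q' θ) + ℓ θ -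
      min (x + p θ) (L θ - x + q θ)) / 2 := by
    refine (((hmin p' q').add (.const ℓ)).sub (hmin p q)).half ?_
    filter_upwards [hodd p q, hodd p' q'] with a h1 h2
    omega
  refine ⟨fun y hy => ?_, ?_, ⟨0, fun _ _ => rfl⟩, ⟨1, fun _ _ => rfl⟩, ?_⟩
  · exact ((hmin p q).add hy).min ((hmin p' q').add ((PiecewiseAffine.const ℓ).sub hy))
  · intro k
    fin_cases k
    · exact .const _
    · exact .const _
    · exact hhalf
    · exact hhalf.add (.const _)
  · intro θ x i hi
    have h2 := hi 2
    have h3 := hi 3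
    simp only [Matrix.cons_val] at h2 h3
    generalize min (x + p' θ) (L θ - x + q' θ) = β at *
    generalize min (x + p θ) (L θ - x + q θ) = α at *
    rcases lt_or_gt_of_ne h2 with h | h
    · exact ⟨1, Or.inl rfl, by omega, by omega⟩
    · exact ⟨-1, Or.inr rfl, by omega, by omega⟩

/-- The slope changes at the source x and at distance M/2 from it on either side, with two break
points per side for the two parities of M. -/
lemma hasBreaks_loop (ℓ M : Θ → ℤ) :
    HasBreaks ℓ (fun θ x i => min |x - i| (M θ - |x - i|))
      ![fun _ _ => 0, fun θ _ => ℓ θ, fun _ x => x, fun θ x => x + M θ / 2,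
        fun θ x => x - M θ / 2, fun θ x => x + (M θ / 2 + 1), fun θ x => x - (M θ / 2 + 1)] := by
  refine ⟨fun y hy => ?_, ?_, ⟨0, fun _ _ => rfl⟩, ⟨1, fun _ _ => rfl⟩, ?_⟩
  · have := (PiecewiseAffine.id.sub hy).abs
    exact this.min ((PiecewiseAffine.const M).sub this)
  · have hx := PiecewiseAffine.id (Θ := Θ)
    intro k
    fin_cases k
    · exact .const _
    · exact .const _
    · exact hx
    · exact hx.add (.const _)
    · exact hx.sub (.const _)
    · exact hx.add (.const _)
    · exact hx.sub (.const _)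
  · intro θ x i hi
    have h2 := hi 2
    have h3 := hi 3
    have h4 := hi 4
    have h5 := hi 5
    have h6 := hi 6
    simp only [Matrix.cons_val] at h2 h3 h4 h5 h6
    rcases lt_or_gt_of_ne h2 with h | h
    · rw [abs_of_pos (by omega : 0 < x - i), abs_of_nonneg (by omega : 0 ≤ x - (i + 1)),
        abs_of_pos (by omega : 0 < x - (i - 1))]
      rcases lt_or_gt_of_ne h4 with h' | h'
      · exact ⟨1, Or.inl rfl, by omega, by omega⟩
      · exact ⟨-1, Or.inr rfl, by omega, by omega⟩
    · rw [abs_of_neg (by omega : x - i < 0), abs_of_neg (by omega : x - (i + 1) < 0),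
        abs_of_nonpos (by omega : x - (i - 1) ≤ 0)]
      rcases lt_or_gt_of_ne h3 with h' | h'
      · exact ⟨1, Or.inl rfl, by omega, by omega⟩
      · exact ⟨-1, Or.inr rfl, by omega, by omega⟩

/-- Superfluous break points do no harm, so both families are kept. This lets one parameter space
contain equal and different branches. -/
lemma HasBreaks.ite {ι κ : Type*} {ℓ : Θ → ℤ} {f g : Θ → ℤ → ℤ → ℤ} {b : ι → Θ → ℤ → ℤ}
    {c : κ → Θ → ℤ → ℤ} (hf : HasBreaks ℓ f b) (hg : HasBreaks ℓ g c) (s : Θ → Prop)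
    [DecidablePred s] :
    HasBreaks ℓ (fun θ x i => if s θ then f θ x i else g θ x i) (Sum.elim b c) := by
  refine ⟨fun y hy => ?_, ?_, ?_, ?_, ?_⟩
  · exact PiecewiseAffine.ite (P := fun θ _ => s θ) (Eventually.of_forall fun _ => Iff.rfl)
      (hf.comp y hy) (hg.comp y hy)
  · rintro (k | k)
    · exact hf.breaks k
    · exact hg.breaks k
  · obtain ⟨k, hk⟩ := hf.zero
    exact ⟨.inl k, hk⟩
  · obtain ⟨k, hk⟩ := hf.length
    exact ⟨.inl k, hk⟩
  · intro θ x i hi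
    by_cases hs : s θ
    · simpa only [hs, if_true] using hf.slope θ x i fun k => hi (.inl k)
    · simpa only [hs, if_false] using hg.slope θ x i fun k => hi (.inr k)

/-- The data that determine the distances between the points of two branches. Either the branches
are equal, or the remaining data are the distances between their ends. -/
structure DistanceProfile where
  same : Bool
  length : ℤ
  sourceLength : ℤ
  p : ℤ
  q : ℤ
  p' : ℤ
  q' : ℤ

/-- The distance between the points at positions `x` and `i` of two branches. For equal branches,
`p` is the distance between the ends. -/
def DistanceProfile.dist (D : DistanceProfile) (x i : ℤ) : ℤ :=
  if D.same then min |x - i| (D.length + D.p - |x - i|) else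
    min (min (x + D.p) (D.sourceLength - x + D.q) + i)
      (min (x + D.p') (D.sourceLength - x + D.q') + (D.length - i))

/-- The pair of profiles serves as the parameter θ, so the uniform bound does not depend on any
graph. -/
theorem exists_bound_changes_levelPlot :
    ∃ N : ℕ, ∀ D E : DistanceProfile, ∃ S : Finset ℤ, S.card ≤ N ∧ ∀ x ∉ S,
      CombEquiv (levelPlot D.length E.length (D.dist x) (E.dist x))
        (levelPlot D.length E.length (D.dist (x + 1)) (E.dist (x + 1))) := by
  have h : ∀ π : DistanceProfile × DistanceProfile → DistanceProfile, HasBreaks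
      (fun θ => (π θ).length) (fun θ => (π θ).dist) _ := fun π =>
    (hasBreaks_loop (fun θ => (π θ).length) (fun θ => (π θ).length + (π θ).p)).ite
      (hasBreaks_tent (fun θ => (π θ).length) (fun θ => (π θ).sourceLength) (fun θ => (π θ).p)
        (fun θ => (π θ).q) (fun θ => (π θ).p') (fun θ => (π θ).q')) (fun θ => (π θ).same)
  obtain ⟨N, hN⟩ := eventually_combEquiv_levelPlot (h Prod.fst) (h Prod.snd)
  exact ⟨N, fun D E => hN (D, E)⟩

end DistanceProfiles

universe u

variable {V : Type u} {G : SimpleGraph V}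

/-! ### Distances along a branch -/

section BranchWalks

namespace IsBranchWalk

variable {x y : V} {w : G.Walk x y}

lemma length_pos (hw : G.IsBranchWalk w) : 0 < w.length := by
  obtain ⟨⟨-, h⟩ | ⟨rfl, h⟩, -⟩ := hw
  · exact h
  · have := h.three_le_length
    rw [Walk.length_copy] at this
    omega

lemma getVert_ne_start (hw : G.IsBranchWalk w) {i : ℕ} (h0 : 0 < i) (h1 : i < w.length) :
    w.getVert i ≠ x := by
  obtain ⟨⟨h, -⟩ | ⟨rfl, h⟩, -⟩ := hw
  · intro he
    have := (h.getVert_eq_start_iff h1.le).1 he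
    omega
  · rw [Walk.copy_rfl_rfl] at h
    intro he
    have := h.getVert_injOn' (show i ≤ w.length - 1 by omega)
      (show 0 ≤ w.length - 1 by omega) (by simpa using he)
    omega

lemma getVert_ne_end (hw : G.IsBranchWalk w) {i : ℕ} (h0 : 0 < i) (h1 : i < w.length) :
    w.getVert i ≠ y := by
  obtain ⟨⟨h, -⟩ | ⟨rfl, h⟩, -⟩ := hw
  · intro he
    have := (h.getVert_eq_end_iff h1.le).1 he
    omega
  · rw [Walk.copy_rfl_rfl] at h
    intro he
    have := h.getVert_injOn' (show i ≤ w.length - 1 by omega)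
      (show 0 ≤ w.length - 1 by omega) (by simpa using he)
    omega

lemma ncard_neighborSet_getVert (hw : G.IsBranchWalk w) {i : ℕ} (h0 : 0 < i)
    (h1 : i < w.length) : (G.neighborSet (w.getVert i)).ncard = 2 :=
  hw.2 _ (w.getVert_mem_support i) (hw.getVert_ne_start h0 h1) (hw.getVert_ne_end h0 h1)

lemma getVert_pred_ne_succ (hw : G.IsBranchWalk w) {i : ℕ} (h1 : i + 1 < w.length) :
    w.getVert i ≠ w.getVert (i + 2) := by
  obtain ⟨⟨h, -⟩ | ⟨rfl, h⟩, -⟩ := hw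
  · intro he
    have := h.getVert_injOn (show i ≤ w.length by omega) (show i + 2 ≤ w.length by omega) he
    omega
  · rw [Walk.copy_rfl_rfl] at h
    have h3 := h.three_le_length
    intro he
    rcases Nat.eq_zero_or_pos i with rfl | hi
    · have := h.getVert_injOn' (show 0 ≤ w.length - 1 by omega)
        (show 0 + 2 ≤ w.length - 1 by omega) he
      omega
    · have := h.getVert_injOn (show 1 ≤ i ∧ i ≤ w.length by omega)
        (show 1 ≤ i + 2 ∧ i + 2 ≤ w.length by omega) he
      omega

/-- The neighbors of an internal vertex are its neighbors on the walk. -/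
lemma eq_or_eq_of_adj (hw : G.IsBranchWalk w) {i : ℕ} (h0 : 0 < i) (h1 : i < w.length) {v : V}
    (hv : G.Adj (w.getVert i) v) : v = w.getVert (i - 1) ∨ v = w.getVert (i + 1) := by
  obtain ⟨i, rfl⟩ := Nat.exists_eq_succ_of_ne_zero h0.ne'
  have hc := hw.ncard_neighborSet_getVert h0 h1
  have hsub : {w.getVert i, w.getVert (i + 2)} ⊆ G.neighborSet (w.getVert (i + 1)) := by
    rintro _ (rfl | rfl)
    · exact (w.adj_getVert_succ (by omega)).symm
    · exact w.adj_getVert_succ h1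
  have heq := Set.eq_of_subset_of_ncard_le hsub
    (by rw [Set.ncard_pair (hw.getVert_pred_ne_succ h1)]; exact hc.le)
    (Set.finite_of_ncard_ne_zero (by rw [Nat.succ_eq_add_one] at hc; omega))
  have : v ∈ G.neighborSet (w.getVert (i + 1)) := hv
  rw [← heq] at this
  simpa using this

lemma toSubgraph_adj_of_adj (hw : G.IsBranchWalk w) {i : ℕ} (h0 : 0 < i) (h1 : i < w.length)
    {v : V} (hv : G.Adj (w.getVert i) v) : w.toSubgraph.Adj (w.getVert i) v := by
  rcases hw.eq_or_eq_of_adj h0 h1 hv with rfl | rfl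
  · have := w.toSubgraph_adj_getVert (show i - 1 < w.length by omega)
    rw [Nat.sub_add_cancel h0] at this
    exact this.symm
  · exact w.toSubgraph_adj_getVert h1

protected lemma reverse (hw : G.IsBranchWalk w) : G.IsBranchWalk w.reverse := by
  refine ⟨?_, fun v hv h1 h2 => hw.2 v (by simpa using hv) h2 h1⟩
  obtain ⟨⟨h, h'⟩ | ⟨rfl, h⟩, -⟩ := hw
  · exact Or.inl ⟨h.reverse, by simpa using h'⟩
  · exact Or.inr ⟨rfl, by simpa using h⟩

/-- Distances from the vertices of a branch walk to a vertex that is not internal to it. -/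
lemma dist_getVert (hw : G.IsBranchWalk w) {v : V} (hr : G.Reachable x v)
    (hv : ∀ j, 0 < j → j < w.length → w.getVert j ≠ v) {i : ℕ} (hi : i ≤ w.length) :
    (G.dist (w.getVert i) v : ℤ) =
      min ((i : ℤ) + G.dist x v) (w.length - i + G.dist y v) := by
  have hxi : G.dist (w.getVert i) x ≤ i := by
    rw [dist_comm]
    refine (dist_le (w.take i)).trans ?_
    simp
  have hyi : G.dist (w.getVert i) y ≤ w.length - i := (dist_le (w.drop i)).trans (by simp)
  have rxi : G.Reachable (w.getVert i) x := ⟨(w.take i).reverse⟩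
  have ryi : G.Reachable (w.getVert i) y := ⟨w.drop i⟩
  apply le_antisymm
  · have t1 := rxi.dist_triangle_left v
    have t2 := ryi.dist_triangle_left v
    omega
  -- The lower bound holds for every walk, by induction on its length: from an internal vertex the
  -- first step moves the position by one and the minimum by at most one, and at an end of `w` the
  -- distance from that end is one of the two terms.
  · have key : ∀ (n : ℕ) (i : ℕ), i ≤ w.length → ∀ p : G.Walk (w.getVert i) v, p.length = n →
        min ((i : ℤ) + G.dist x v) (w.length - i + G.dist y v) ≤ n := by
      intro n
      induction n with
      | zero =>
        intro i hi p hp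
        have hiv := Walk.eq_of_length_eq_zero hp
        rcases Nat.eq_zero_or_pos i with rfl | h0
        · rw [Walk.getVert_zero] at hiv
          subst hiv
          simp
        · rcases eq_or_lt_of_le hi with rfl | h1
          · rw [Walk.getVert_length] at hiv
            subst hiv
            simp
          · exact absurd hiv (hv i h0 h1)
      | succ n ih =>
        intro i hi p hp
        rcases Nat.eq_zero_or_pos i with rfl | h0
        · have := dist_le (p.copy w.getVert_zero rfl)
          rw [Walk.length_copy] at this
          omega
        rcases eq_or_lt_of_le hi with rfl | h1
        · have := dist_le (p.copy w.getVert_length rfl)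
          rw [Walk.length_copy] at this
          omega
        cases p with
        | nil => simp at hp
        | @cons _ z _ h p =>
          rw [Walk.length_cons] at hp
          rcases hw.eq_or_eq_of_adj h0 h1 h with rfl | rfl
          · have := ih (i - 1) (by omega) p (by omega)
            omega
          · have := ih (i + 1) (by omega) p (by omega)
            omega
    obtain ⟨p, hp⟩ := (rxi.trans hr).exists_walk_length_eq_dist
    exact key _ i hi p hp

/-- Distances between the vertices of a branch walk. -/
lemma dist_getVert_getVert (hw : G.IsBranchWalk w) {i j : ℕ} (hi : i ≤ w.length)
    (hj : j ≤ w.length) :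
    (G.dist (w.getVert i) (w.getVert j) : ℤ) =
      min |(i : ℤ) - j| (w.length + G.dist x y - |(i : ℤ) - j|) := by
  have hxy : G.dist x y ≤ w.length := dist_le w
  have rxy : G.Reachable x y := ⟨w⟩
  have hx : ∀ {i : ℕ}, i ≤ w.length → (G.dist (w.getVert i) x : ℤ) =
      min (i : ℤ) (w.length - i + G.dist x y) := by
    intro i hi
    rw [hw.dist_getVert (Reachable.refl x) (fun k h0 h1 => hw.getVert_ne_start h0 h1) hi,
      dist_self, dist_comm (u := y)]
    simp
  have hy : ∀ {i : ℕ}, i ≤ w.length → (G.dist (w.getVert i) y : ℤ) =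
      min (i + G.dist x y : ℤ) (w.length - i) := by
    intro i hi
    rw [hw.dist_getVert rxy (fun k h0 h1 => hw.getVert_ne_end h0 h1) hi, dist_self]
    simp
  have upper : ∀ {i j : ℕ}, i ≤ j → j ≤ w.length →
      (G.dist (w.getVert i) (w.getVert j) : ℤ) ≤
        min ((j : ℤ) - i) (w.length + G.dist x y - (j - i)) := by
    intro i j hij hj
    have h1 : G.dist (w.getVert i) (w.getVert j) ≤ j - i := by
      have := dist_le (((w.drop i).take (j - i)).copy rfl
        (by rw [Walk.drop_getVert, Nat.add_sub_cancel' hij]))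
      refine this.trans ?_
      simp
    have rxi : G.Reachable (w.getVert i) x := ⟨(w.take i).reverse⟩
    have ryj : G.Reachable (w.getVert j) y := ⟨w.drop j⟩
    have t1 := rxi.dist_triangle_left (w.getVert j)
    have t2 := rxy.dist_triangle_left (w.getVert j)
    have h2 := hx (hij.trans hj)
    have h3 := hy hj
    rw [dist_comm] at h3
    omega
  apply le_antisymm
  · rcases le_total i j with hij | hij
    · have := upper hij hj
      rw [abs_sub_comm, abs_of_nonneg (by omega)]
      exact this
    · have := upper hij hi
      rw [abs_of_nonneg (by omega), dist_comm]
      exact this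
  · have key : ∀ (n : ℕ) (i : ℕ), i ≤ w.length → ∀ v, v = w.getVert j →
        ∀ p : G.Walk (w.getVert i) v, p.length = n → min |(i : ℤ) - j| (w.length + G.dist x y - |(i : ℤ) - j|) ≤ n := by
      intro n
      induction n with
      | zero =>
        intro i hi v hv p hp
        have hij := (Walk.eq_of_length_eq_zero hp).trans hv
        by_cases he : i = j
        · subst he
          simp
        -- Only the closing vertex of a cycle has two positions; there the second term of the
        -- minimum is 0.
        · have hends : (i = 0 ∧ j = w.length) ∨ (i = w.length ∧ j = 0) := by
            have inj : ∀ {i j : ℕ}, i < j → j ≤ w.length → w.getVert i = w.getVert j →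
                i = 0 ∧ j = w.length := by
              intro i j hlt hj hij
              obtain ⟨⟨h, -⟩ | ⟨rfl, h⟩, -⟩ := hw
              · have := h.getVert_injOn (show i ≤ w.length by omega) hj hij
                omega
              · rw [Walk.copy_rfl_rfl] at h
                by_contra hc
                rcases Nat.eq_zero_or_pos i with rfl | h0
                · have := h.getVert_injOn' (show 0 ≤ w.length - 1 by omega)
                    (show j ≤ w.length - 1 by omega) hij
                  omega
                · have := h.getVert_injOn (show 1 ≤ i ∧ i ≤ w.length by omega)
                    (show 1 ≤ j ∧ j ≤ w.length by omega) hij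
                  omega
            rcases lt_or_gt_of_ne he with hlt | hlt
            · exact Or.inl (inj hlt hj hij)
            · exact Or.inr (inj hlt hi hij.symm).symm
          have hxy0 : G.dist x y = 0 := by
            have : x = y := by
              rcases hends with ⟨rfl, rfl⟩ | ⟨rfl, rfl⟩
              · simpa using hij
              · simpa using hij.symm
            rw [this, dist_self]
          rw [hxy0]
          rcases hends with ⟨rfl, rfl⟩ | ⟨rfl, rfl⟩ <;> simp
      | succ n ih =>
        intro i hi v hv p hp
        rcases Nat.eq_zero_or_pos i with rfl | h0
        · have := dist_le (p.copy w.getVert_zero hv)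
          rw [Walk.length_copy, dist_comm] at this
          have h' := hx hj
          rw [abs_sub_comm, abs_of_nonneg (by omega)]
          omega
        rcases eq_or_lt_of_le hi with rfl | h1
        · have := dist_le (p.copy w.getVert_length hv)
          rw [Walk.length_copy, dist_comm] at this
          have h' := hy hj
          rw [abs_of_nonneg (by omega)]
          omega
        cases p with
        | nil => simp at hp
        | @cons _ z _ h p =>
          rw [Walk.length_cons] at hp
          rcases hw.eq_or_eq_of_adj h0 h1 h with rfl | rfl
          · have := ih (i - 1) (by omega) v hv p (by omega)
            have h2 := abs_cases ((i : ℤ) - j)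
            have h3 := abs_cases (((i - 1 : ℕ) : ℤ) - j)
            omega
          · have := ih (i + 1) (by omega) v hv p (by omega)
            have h2 := abs_cases ((i : ℤ) - j)
            have h3 := abs_cases (((i + 1 : ℕ) : ℤ) - j)
            omega
    have rij : G.Reachable (w.getVert i) (w.getVert j) :=
      ⟨(w.take i).reverse.append (w.take j)⟩
    obtain ⟨p, hp⟩ := rij.exists_walk_length_eq_dist
    exact key _ i hi _ rfl p hp

end IsBranchWalk

end BranchWalks

/-! ### Maximality: branches share no internal vertices -/

section Branches

/-- An edge at an end of degree two can be prepended to a path unless it is already the first edge,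
giving a longer path or a cycle; maximality then puts it in the branch. In a cycle the first and
last edge are already the two edges at x. -/
lemma IsBranchWalk.toSubgraph_adj_start {x y : V} {w : G.Walk x y} (hw : G.IsBranchWalk w)
    (hmax : G.IsBranch w.toSubgraph) (hx : (G.neighborSet x).ncard = 2) {v : V}
    (hv : G.Adj x v) : w.toSubgraph.Adj x v := by
  have hpos := hw.length_pos
  have h1 : w.toSubgraph.Adj x (w.getVert 1) := by
    simpa using w.toSubgraph_adj_getVert hpos
  obtain ⟨hpath, -⟩ | ⟨rfl, hcyc⟩ := hw.1
  · by_cases hv1 : v = w.getVert 1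
    · rwa [hv1]
    have hK : G.IsBranchWalk (Walk.cons hv.symm w) → w.toSubgraph.Adj x v := by
      intro h
      have hle := hmax.2 ⟨_, _, _, h, rfl⟩ le_sup_right
      exact hle.2 (Or.inl (by simp [Sym2.eq_swap]))
    by_cases hmem : v ∈ w.support
    · obtain ⟨j, rfl, hj⟩ := Walk.mem_support_iff_exists_getVert.1 hmem
      have hj0 : j ≠ 0 := by
        rintro rfl
        simp at hv
      have hj1 : j ≠ 1 := by
        rintro rfl
        exact hv1 rfl
      rcases eq_or_lt_of_le hj with rfl | hlt
      · apply hK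
        have hy := w.getVert_length
        have hcc : ∀ z (hz : z = y) (h : G.Adj z x),
            ((Walk.cons h w).copy rfl hz.symm).IsCycle := by
          rintro _ rfl h
          rw [Walk.copy_rfl_rfl, Walk.cons_isCycle_iff]
          refine ⟨hpath, fun he => ?_⟩
          have := hpath.length_eq_one_of_mem_edges (by rwa [Sym2.eq_swap])
          omega
        refine ⟨Or.inr ⟨hy, hcc _ hy _⟩, ?_⟩
        · intro u hu hu1 hu2
          rw [Walk.support_cons, List.mem_cons] at hu
          rcases hu with hu | hu
          · exact absurd hu hu1
          · by_cases hux : u = x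
            · rwa [hux]
            · exact hw.2 u hu hux hu2
      -- An internal vertex is adjacent only to its neighbors on the walk, so it could be adjacent
      -- to x only at position 1.
      · exfalso
        rcases hw.eq_or_eq_of_adj (by omega) hlt hv.symm with he | he
        · have := (hpath.getVert_eq_start_iff (by omega)).1 he.symm
          omega
        · have := (hpath.getVert_eq_start_iff (by omega)).1 he.symm
          omega
    · apply hK
      refine ⟨Or.inl ⟨(Walk.cons_isPath_iff _ _).2 ⟨hpath, hmem⟩, by simp⟩, ?_⟩
      intro u hu hu1 hu2
      rw [Walk.support_cons, List.mem_cons] at hu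
      rcases hu with hu | hu
      · exact absurd hu hu1
      · by_cases hux : u = x
        · rwa [hux]
        · exact hw.2 u hu hux hu2
  · rw [Walk.copy_rfl_rfl] at hcyc
    have h3 := hcyc.three_le_length
    have h2 : w.toSubgraph.Adj x (w.getVert (w.length - 1)) := by
      have := w.toSubgraph_adj_getVert (show w.length - 1 < w.length by omega)
      rw [Nat.sub_add_cancel hpos, Walk.getVert_length] at this
      exact this.symm
    have hne : w.getVert 1 ≠ w.getVert (w.length - 1) := by
      intro he
      have := hcyc.getVert_injOn (show 1 ≤ 1 ∧ 1 ≤ w.length by omega)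
        (show 1 ≤ w.length - 1 ∧ w.length - 1 ≤ w.length by omega) he
      omega
    have hsub : {w.getVert 1, w.getVert (w.length - 1)} ⊆ G.neighborSet x := by
      rintro _ (rfl | rfl)
      · exact h1.adj_sub
      · exact h2.adj_sub
    have heq := Set.eq_of_subset_of_ncard_le hsub
      (by rw [Set.ncard_pair hne]; exact hx.le)
      (Set.finite_of_ncard_ne_zero (by omega))
    have : v ∈ G.neighborSet x := hv
    rw [← heq] at this
    rcases this with rfl | rfl
    · exact h1
    · exact h2

namespace Branch

variable {A C : G.Branch}

/-- A branch contains the edges at its vertices of degree two. -/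
lemma adj_of_ncard_eq_two (A : G.Branch) {u v : V} (hu : u ∈ A.1.verts)
    (h2 : (G.neighborSet u).ncard = 2) (huv : G.Adj u v) : A.1.Adj u v := by
  obtain ⟨H, hH⟩ := A
  obtain ⟨x, y, w, hw, rfl⟩ := hH.1
  rw [Walk.mem_verts_toSubgraph, Walk.mem_support_iff_exists_getVert] at hu
  obtain ⟨i, rfl, hi⟩ := hu
  rcases Nat.eq_zero_or_pos i with rfl | h0
  · rw [Walk.getVert_zero] at *
    exact hw.toSubgraph_adj_start hH h2 huv
  rcases eq_or_lt_of_le hi with rfl | h1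
  · rw [Walk.getVert_length] at *
    have := hw.reverse.toSubgraph_adj_start (by rwa [Walk.toSubgraph_reverse]) h2 huv
    rwa [Walk.toSubgraph_reverse] at this
  · exact hw.toSubgraph_adj_of_adj h0 h1 huv

/-- Two branches that share a vertex of degree two are equal. -/
lemma eq_of_ncard_eq_two {v : V} (hA : v ∈ A.1.verts) (hC : v ∈ C.1.verts)
    (h2 : (G.neighborSet v).ncard = 2) : A = C := by
  suffices hle : C.1 ≤ A.1 from Subtype.ext (le_antisymm (C.2.2 A.2.1 hle) hle)
  obtain ⟨H, hH⟩ := C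
  obtain ⟨x, y, w, hw, rfl⟩ := hH.1
  simp only at hC ⊢
  rw [Walk.mem_verts_toSubgraph, Walk.mem_support_iff_exists_getVert] at hC
  obtain ⟨k, rfl, hk⟩ := hC
  -- From the shared vertex the edges of the walk are followed in both directions; each vertex
  -- before an end has degree two, so its next edge is again in `A`.
  have up : ∀ n, k + n < w.length →
      A.1.Adj (w.getVert (k + n)) (w.getVert (k + n + 1)) := by
    intro n
    induction n with
    | zero => exact fun h => A.adj_of_ncard_eq_two hA h2 (w.adj_getVert_succ h)
    | succ n ih =>
      intro h
      exact A.adj_of_ncard_eq_two (ih (by omega)).snd_mem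
        (hw.ncard_neighborSet_getVert (by omega) h) (w.adj_getVert_succ h)
  have down : ∀ n, n < k → A.1.Adj (w.getVert (k - n)) (w.getVert (k - n - 1)) := by
    have hadj : ∀ j, 0 < j → j ≤ w.length → G.Adj (w.getVert j) (w.getVert (j - 1)) := by
      intro j h0 hj
      have := w.adj_getVert_succ (show j - 1 < w.length by omega)
      rw [Nat.sub_add_cancel h0] at this
      exact this.symm
    intro n
    induction n with
    | zero => exact fun h => A.adj_of_ncard_eq_two hA h2 (hadj k h hk)
    | succ n ih =>
      intro h
      exact A.adj_of_ncard_eq_two (ih (by omega)).snd_mem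
        (hw.ncard_neighborSet_getVert (i := k - n - 1) (by omega) (by omega))
        (hadj _ (by omega) (by omega))
  have hedge : ∀ i, i < w.length → A.1.Adj (w.getVert i) (w.getVert (i + 1)) := by
    intro i hi
    rcases le_or_gt k i with hki | hki
    · have := up (i - k) (by omega)
      rwa [Nat.add_sub_cancel' hki] at this
    · have := down (k - 1 - i) (by omega)
      rw [show k - (k - 1 - i) = i + 1 by omega, Nat.add_sub_cancel] at this
      exact this.symm
  rw [Walk.toSubgraph_le_iff (Walk.not_nil_iff_lt_length.2 hw.length_pos)]
  rintro ⟨a, b⟩ hab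
  have hab' : w.toSubgraph.Adj a b := w.mem_edges_toSubgraph.2 hab
  obtain ⟨i, he, hi⟩ := w.toSubgraph_adj_iff.1 hab'
  have := hedge i hi
  rw [← Subgraph.mem_edgeSet, he] at this
  exact this

namespace Coordinate

lemma mem_verts_iff (c : A.Coordinate) {v : V} :
    v ∈ A.1.verts ↔ ∃ i, c.walk.getVert i = v ∧ i ≤ c.walk.length := by
  rw [← c.toSubgraph_eq, Walk.mem_verts_toSubgraph, Walk.mem_support_iff_exists_getVert]

lemma getVert_mem (c : A.Coordinate) (i : ℕ) : c.walk.getVert i ∈ A.1.verts := by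
  rw [← c.toSubgraph_eq, Walk.mem_verts_toSubgraph]
  exact c.walk.getVert_mem_support i

lemma getVert_ne_of_mem (c : A.Coordinate) (hne : A ≠ C) {v : V} (hv : v ∈ C.1.verts) (i : ℕ)
    (h0 : 0 < i) (h1 : i < c.walk.length) : c.walk.getVert i ≠ v := by
  rintro rfl
  exact hne (eq_of_ncard_eq_two (c.getVert_mem i) hv
    (c.isBranchWalk.ncard_neighborSet_getVert h0 h1))

/-- The data that determine the distances between the vertices of two branches. -/
noncomputable def distanceProfile [DecidableEq G.Branch] (c : C.Coordinate) (a : A.Coordinate) :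
    DistanceProfile where
  same := C = A
  length := a.walk.length
  sourceLength := c.walk.length
  p := if C = A then G.dist a.first a.last else G.dist c.first a.first
  q := G.dist c.last a.first
  p' := G.dist c.first a.last
  q' := G.dist c.last a.last

/-- For different branches the formula for distances to a non-internal vertex is used along `A`, and
then along `C` for each end of `A`. Reachability is needed because `G.dist` is 0 between components.
-/
lemma dist_eq [DecidableEq G.Branch] (P : ∀ A : G.Branch, A.Coordinate)
    (hr : G.Reachable (P C).first (P A).first) {x i : ℕ} (hx : x ≤ (P C).walk.length)
    (hi : i ≤ (P A).walk.length) :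
    (G.dist ((P C).walk.getVert x) ((P A).walk.getVert i) : ℤ) =
      ((P C).distanceProfile (P A)).dist x i := by
  by_cases hCA : C = A
  · subst hCA
    simp only [DistanceProfile.dist, distanceProfile, decide_true, if_true]
    exact (P C).isBranchWalk.dist_getVert_getVert hx hi
  · simp only [DistanceProfile.dist, distanceProfile, hCA, decide_false, if_false]
    have rC : G.Reachable (P C).first ((P C).walk.getVert x) := ⟨(P C).walk.take x⟩
    have rA : G.Reachable (P A).first (P A).last := ⟨(P A).walk⟩
    rw [dist_comm, (P A).isBranchWalk.dist_getVert (hr.symm.trans rC)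
      ((P A).getVert_ne_of_mem (Ne.symm hCA) ((P C).getVert_mem x)) hi,
      dist_comm (u := (P A).first), dist_comm (u := (P A).last),
      (P C).isBranchWalk.dist_getVert hr ((P C).getVert_ne_of_mem hCA
        (by simpa using (P A).getVert_mem 0)) hx,
      (P C).isBranchWalk.dist_getVert (hr.trans rA) ((P C).getVert_ne_of_mem hCA
        (by simpa using (P A).getVert_mem (P A).walk.length)) hx]
    simp only [Bool.false_eq_true, if_false]
    rw [add_comm (x : ℤ), add_comm ((P C).walk.length - x : ℤ)]
    congr 1
    · ring
    · ring

end Coordinate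

end Branch

end Branches

/-! ### Combinatorial equivalence is an equivalence relation -/

section CombEquivRelation

/-- The order condition speaks of arbitrary intersection points on both sides, so it must be known
that distinct diagonals meet at only one abscissa. -/
lemma CombEquiv.refl (I : Set (ℤ × ℤ)) : CombEquiv I I := by
  refine ⟨Equiv.refl _, fun _ _ => Iff.rfl, fun _ _ => Iff.rfl, ?_⟩
  intro D E F hDE hDF hEF p hp q hq p' hp' q' hq'
  have unique : ∀ {D E : {D // IsDiagonal I D}}, D ≠ E → ∀ {p p' : ℝ × ℝ},
      p ∈ realSegment D.1 ∩ realSegment E.1 → p' ∈ realSegment D.1 ∩ realSegment E.1 →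
      p.1 = p'.1 := by
    rintro ⟨D, hD⟩ ⟨E, hE⟩ hne p p' hp hp'
    obtain ⟨a, b, σ, hσ, h, rfl⟩ := hD.exists_isEndpoints
    obtain ⟨a', b', σ', hσ', h', rfl⟩ := hE.exists_isEndpoints
    have hne' : diagRun a b σ ≠ diagRun a' b' σ' := fun he => hne (Subtype.ext he)
    have e1 := two_mul_fst_of_mem_inter hσ hσ' h h' hne' hp
    have e2 := two_mul_fst_of_mem_inter hσ hσ' h h' hne' hp'
    linarith
  rw [unique hDE hp hp', unique hDF hq hq']

lemma CombEquiv.symm {I J : Set (ℤ × ℤ)} (h : CombEquiv I J) : CombEquiv J I := by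
  obtain ⟨e, h1, h2, h3⟩ := h
  refine ⟨e.symm, fun D σ => ?_, fun D E => ?_, ?_⟩
  · rw [h1, e.apply_symm_apply]
  · rw [h2, e.apply_symm_apply, e.apply_symm_apply]
  · intro D E F hDE hDF hEF p hp q hq p' hp' q' hq'
    have := h3 (e.symm D) (e.symm E) (e.symm F) (e.symm.injective.ne hDE)
      (e.symm.injective.ne hDF) (e.symm.injective.ne hEF) p' hp' q' hq' p (by simpa using hp) q
      (by simpa using hq)
    exact this.symm

lemma CombEquiv.trans {I J K : Set (ℤ × ℤ)} (h : CombEquiv I J) (h' : CombEquiv J K) :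
    CombEquiv I K := by
  obtain ⟨e, h1, h2, h3⟩ := h
  obtain ⟨e', h1', h2', h3'⟩ := h'
  refine ⟨e.trans e', fun D σ => (h1 D σ).trans (h1' _ σ),
    fun D E => (h2 D E).trans (h2' _ _), ?_⟩
  intro D E F hDE hDF hEF p hp q hq p'' hp'' q'' hq''
  obtain ⟨p', hp'⟩ := (h2 D E).1 ⟨p, hp⟩
  obtain ⟨q', hq'⟩ := (h2 D F).1 ⟨q, hq⟩
  exact (h3 D E F hDE hDF hEF p hp q hq p' hp' q' hq').trans
    (h3' (e D) (e E) (e F) (e.injective.ne hDE) (e.injective.ne hDF) (e.injective.ne hEF)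
      p' hp' q' hq' p'' hp'' q'' hq'')

end CombEquivRelation

/-! ### Counting stems by their last positions -/

section StemCount

variable {V : Type u} {G : SimpleGraph V} (P : ∀ A : G.Branch, A.Coordinate)

lemma indistinctPlot_eq_levelPlot [DecidableEq G.Branch] {A B C : G.Branch}
    (hA : G.Reachable (P C).first (P A).first) (hB : G.Reachable (P C).first (P B).first) {x : ℕ}
    (hx : x ≤ (P C).walk.length) :
    indistinctPlot P ((P C).walk.getVert x) A B =
      levelPlot ((P C).distanceProfile (P A)).length ((P C).distanceProfile (P B)).length
        (((P C).distanceProfile (P A)).dist x) (((P C).distanceProfile (P B)).dist x) := by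
  have key : ∀ i j : ℕ, i ≤ (P A).walk.length → j ≤ (P B).walk.length →
      (((P A).walk.getVert i, (P B).walk.getVert j) ∈
        indistinctSet ((P C).walk.getVert x) A B ↔
      ((P C).distanceProfile (P A)).dist x i = ((P C).distanceProfile (P B)).dist x j) := by
    intro i j hi hj
    have rC : G.Reachable (P C).first ((P C).walk.getVert x) := ⟨(P C).walk.take x⟩
    have rA : G.Reachable ((P C).walk.getVert x) ((P A).walk.getVert i) :=
      (rC.symm.trans hA).trans ⟨(P A).walk.take i⟩
    have rB : G.Reachable ((P C).walk.getVert x) ((P B).walk.getVert j) :=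
      (rC.symm.trans hB).trans ⟨(P B).walk.take j⟩
    rw [← Branch.Coordinate.dist_eq P hA hx hi, ← Branch.Coordinate.dist_eq P hB hx hj,
      Nat.cast_inj, ← @Nat.cast_inj ℕ∞, rA.coe_dist_eq_edist, rB.coe_dist_eq_edist]
    exact ⟨fun h => h.2.2, fun h => ⟨(P A).getVert_mem i, (P B).getVert_mem j, h⟩⟩
  ext ⟨a, b⟩
  constructor
  · rintro ⟨i, j, hi, hj, he, hm⟩
    obtain ⟨rfl, rfl⟩ := Prod.mk.inj he
    exact ⟨⟨by simp, Int.ofNat_le.2 hi⟩, ⟨by simp, Int.ofNat_le.2 hj⟩, (key i j hi hj).1 hm⟩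
  · rintro ⟨⟨a0, a1⟩, ⟨b0, b1⟩, h⟩
    obtain ⟨i, rfl⟩ := Int.eq_ofNat_of_zero_le a0
    obtain ⟨j, rfl⟩ := Int.eq_ofNat_of_zero_le b0
    have hi := Int.ofNat_le.1 a1
    have hj := Int.ofNat_le.1 b1
    exact ⟨i, j, hi, hj, rfl, (key i j hi hj).2 h⟩

/-- If `A` or `B` lies in another component than `C`, an equality of distances forces both to be
infinite, which does not depend on the position in `C`. -/
lemma indistinctPlot_subset_of_not_reachable {A B C : G.Branch}
    (h : ¬ (G.Reachable (P C).first (P A).first ∧ G.Reachable (P C).first (P B).first))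
    (x y : ℕ) :
    indistinctPlot P ((P C).walk.getVert x) A B ⊆ indistinctPlot P ((P C).walk.getVert y) A B := by
  have hr : ∀ (A : G.Branch) (x i : ℕ),
      G.edist ((P C).walk.getVert x) ((P A).walk.getVert i) = ⊤ ↔
        ¬ G.Reachable (P C).first (P A).first := by
    intro A x i
    rw [← not_iff_not, not_not, ← ne_eq, edist_ne_top_iff_reachable]
    have rC : G.Reachable (P C).first ((P C).walk.getVert x) := ⟨(P C).walk.take x⟩
    have rA : G.Reachable (P A).first ((P A).walk.getVert i) := ⟨(P A).walk.take i⟩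
    exact ⟨fun h => (rC.trans h).trans rA.symm, fun h => (rC.symm.trans h).trans rA⟩
  rintro q ⟨i, j, hi, hj, rfl, hA, hB, he⟩
  refine ⟨i, j, hi, hj, rfl, hA, hB, ?_⟩
  simp only at he ⊢
  have hAB : ¬ G.Reachable (P C).first (P A).first ∧ ¬ G.Reachable (P C).first (P B).first := by
    by_cases hA : G.Reachable (P C).first (P A).first
    · have h1 := (hr B x j).2 fun hB => h ⟨hA, hB⟩
      rw [h1, hr] at he
      exact absurd hA he
    · have h1 := (hr A x i).2 hA
      rw [h1] at he
      exact ⟨hA, (hr B x j).1 he.symm⟩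
  rw [(hr A y i).2 hAB.1, (hr B y j).2 hAB.2]

/-- Along a branch, the combinatorial structure of the indistinct sets for two branches changes a
bounded number of times. -/
theorem exists_bound_changes_indistinctPlot :
    ∃ N : ℕ, ∀ (V : Type u) (G : SimpleGraph V) (P : ∀ A : G.Branch, A.Coordinate)
      (C A B : G.Branch), ∃ S : Finset ℕ, S.card ≤ N ∧ ∀ x < (P C).walk.length, x ∉ S →
        CombEquiv (indistinctPlot P ((P C).walk.getVert x) A B)
          (indistinctPlot P ((P C).walk.getVert (x + 1)) A B) := by
  classical
  obtain ⟨N, hN⟩ := exists_bound_changes_levelPlot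
  refine ⟨N, fun V G P C A B => ?_⟩
  by_cases hr : G.Reachable (P C).first (P A).first ∧ G.Reachable (P C).first (P B).first
  · obtain ⟨S, hS, h⟩ := hN ((P C).distanceProfile (P A)) ((P C).distanceProfile (P B))
    refine ⟨S.preimage (fun n : ℕ => (n : ℤ)) (Nat.cast_injective.injOn), ?_, fun x hx hxS => ?_⟩
    · refine le_trans ?_ hS
      exact Finset.card_le_card_of_injOn (fun n : ℕ => (n : ℤ))
        (fun n hn => Finset.mem_preimage.1 hn) Nat.cast_injective.injOn
    · rw [indistinctPlot_eq_levelPlot P hr.1 hr.2 hx.le, indistinctPlot_eq_levelPlot P hr.1 hr.2 hx]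
      push_cast
      exact h x fun hm => hxS (Finset.mem_preimage.2 hm)
  · refine ⟨∅, by simp, fun x _ _ => ?_⟩
    rw [(indistinctPlot_subset_of_not_reachable P hr x (x + 1)).antisymm
      (indistinctPlot_subset_of_not_reachable P hr (x + 1) x)]
    exact .refl _

variable {P}

/-- Equivalences are composed through the common vertex. Hence overlapping stems coincide. -/
lemma IsStructurallyUniform.union {C : G.Branch} {S T : Set V}
    (hS : IsStructurallyUniform P C S) (hT : IsStructurallyUniform P C T) {v : V} (hvS : v ∈ S)
    (hvT : v ∈ T) : IsStructurallyUniform P C (S ∪ T) := by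
  refine ⟨Set.union_subset hS.1 hT.1, Subgraph.induce_union_connected hS.2.1.preconnected
    hT.2.1.preconnected ⟨v, hvS, hvT⟩, fun A B => ?_⟩
  have h : ∀ s ∈ S ∪ T, CombEquiv (indistinctPlot P s A B) (indistinctPlot P v A B) := by
    rintro s (hs | hs)
    · exact hS.2.2 A B s hs v hvS
    · exact hT.2.2 A B s hs v hvT
  exact fun s hs t ht => (h s hs).trans (h t ht).symm

lemma isStructurallyUniform_pair {C : G.Branch} {u v : V} (huv : C.1.Adj u v)
    (h : ∀ A B, CombEquiv (indistinctPlot P u A B) (indistinctPlot P v A B)) :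
    IsStructurallyUniform P C {u, v} := by
  refine ⟨?_, ?_, fun A B => ?_⟩
  · rintro _ (rfl | rfl)
    · exact huv.fst_mem
    · exact huv.snd_mem
  · have hle : G.subgraphOfAdj huv.adj_sub ≤ C.1.induce {u, v} := by
      refine ⟨le_rfl, fun a b hab => ?_⟩
      rw [subgraphOfAdj_adj, Sym2.eq_iff] at hab
      rcases hab with ⟨rfl, rfl⟩ | ⟨rfl, rfl⟩
      · exact ⟨by simp, by simp, huv⟩
      · exact ⟨by simp, by simp, huv.symm⟩
    exact (Subgraph.subgraphOfAdj_connected huv.adj_sub).mono hle rfl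
  · have h' : ∀ s ∈ ({u, v} : Set V), CombEquiv (indistinctPlot P s A B)
        (indistinctPlot P u A B) := by
      rintro s (rfl | rfl)
      · exact .refl _
      · exact (h A B).symm
    exact fun s hs t ht => (h' s hs).trans (h' t ht).symm

/-- The last position in a stem is the last position in the branch or a position at which some
combinatorial structure changes. -/
lemma IsStem.exists_last {C : G.Branch} {S : Set V} (hS : IsStem P C S) :
    ∃ x ≤ (P C).walk.length, (P C).walk.getVert x ∈ S ∧ (x < (P C).walk.length →
      ∃ A B, ¬ CombEquiv (indistinctPlot P ((P C).walk.getVert x) A B)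
        (indistinctPlot P ((P C).walk.getVert (x + 1)) A B)) := by
  classical
  obtain ⟨v, hv⟩ := hS.1.2.1.nonempty
  obtain ⟨i, hi, hiL⟩ := (P C).mem_verts_iff.1 (hS.1.1 hv)
  have hspec := Nat.findGreatest_spec (P := fun x => (P C).walk.getVert x ∈ S) hiL
    (by rw [hi]; exact hv)
  have hle := Nat.findGreatest_le (P := fun x => (P C).walk.getVert x ∈ S) (P C).walk.length
  have hgt := fun k => Nat.findGreatest_is_greatest (P := fun x => (P C).walk.getVert x ∈ S)
    (n := (P C).walk.length) (k := k)
  refine ⟨_, hle, hspec, fun hlt => ?_⟩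
  -- Without a change the next position could be joined to the stem, so by maximality it would
  -- already belong to it.
  by_contra! hc
  refine hgt _ (Nat.lt_succ_self _) hlt ?_
  have hadj := (P C).walk.toSubgraph_adj_getVert hlt
  rw [(P C).toSubgraph_eq] at hadj
  have hu := hS.1.union (isStructurallyUniform_pair hadj hc) hspec (by simp)
  exact hS.2 hu Set.subset_union_left (Or.inr (by simp))

lemma IsStem.eq_of_mem {C : G.Branch} {S T : Set V} (hS : IsStem P C S) (hT : IsStem P C T)
    {v : V} (hvS : v ∈ S) (hvT : v ∈ T) : S = T := by
  have hu := hS.1.union hT.1 hvS hvT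
  exact (Set.subset_union_left.trans (hT.2 hu Set.subset_union_right)).antisymm
    (Set.subset_union_right.trans (hS.2 hu Set.subset_union_left))

/-- A stem is determined by its branch and any one of its positions, since stems of a branch are
disjoint. For each branch the chosen position is the end or lies in one of b² exceptional sets of
size at most N. -/
theorem ncard_stems_le [Finite V] {N : ℕ}
    (hN : ∀ C A B : G.Branch, ∃ S : Finset ℕ, S.card ≤ N ∧ ∀ x < (P C).walk.length, x ∉ S →
        CombEquiv (indistinctPlot P ((P C).walk.getVert x) A B)
          (indistinctPlot P ((P C).walk.getVert (x + 1)) A B)) :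
    (stems P).ncard ≤ (N + 1) * Nat.card G.Branch ^ 3 := by
  classical
  have : Fintype G.Branch := Fintype.ofFinite _
  choose R hR hR' using hN
  let Z : G.Branch → Finset ℕ := fun C =>
    insert (P C).walk.length (Finset.univ.biUnion fun A => Finset.univ.biUnion fun B => R C A B)
  let W : Finset (G.Branch × ℕ) := Finset.univ.biUnion fun C => (Z C).image (Prod.mk C)
  have hlast : ∀ a : G.Branch × Set V, ∃ x : ℕ, a ∈ stems P →
      (P a.1).walk.getVert x ∈ a.2 ∧ x ∈ Z a.1 := by
    rintro ⟨C, S⟩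
    by_cases hS : (C, S) ∈ stems P
    · obtain ⟨x, hx, hxS, h⟩ := IsStem.exists_last (P := P) (C := C) (S := S) hS
      refine ⟨x, fun _ => ⟨hxS, ?_⟩⟩
      rcases eq_or_lt_of_le hx with rfl | hlt
      · exact Finset.mem_insert_self _ _
      · obtain ⟨A, B, hAB⟩ := h hlt
        refine Finset.mem_insert_of_mem ?_
        simp only [Finset.mem_biUnion, Finset.mem_univ, true_and]
        exact ⟨A, B, by_contra fun hm => hAB (hR' C A B x hlt hm)⟩
    · exact ⟨0, fun h => absurd h hS⟩
  choose φ hφ using hlast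
  have h1 : (stems P).ncard ≤ (W : Set (G.Branch × ℕ)).ncard := by
    refine Set.ncard_le_ncard_of_injOn (fun a => (a.1, φ a)) ?_ ?_ W.finite_toSet
    · intro a ha
      simp only [W, Finset.coe_biUnion, Set.mem_iUnion]
      exact ⟨a.1, by simp, by simpa using (hφ a ha).2⟩
    · rintro ⟨C, S⟩ hS ⟨D, T⟩ hT he
      obtain ⟨rfl, he⟩ := Prod.mk.inj he
      simp only at he
      have hvS := (hφ _ hS).1
      have hvT := (hφ _ hT).1
      rw [he] at hvS
      exact Prod.ext rfl (IsStem.eq_of_mem (P := P) (C := C) hS hT hvS hvT)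
  rw [Set.ncard_coe_finset] at h1
  have h2 : W.card ≤ Fintype.card G.Branch *
      (Fintype.card G.Branch * (Fintype.card G.Branch * N) + 1) := by
    refine Finset.card_biUnion_le_card_mul _ _ _ fun C _ => Finset.card_image_le.trans ?_
    refine (Finset.card_insert_le _ _).trans (Nat.add_le_add_right ?_ 1)
    refine Finset.card_biUnion_le_card_mul _ _ _ fun A _ => ?_
    exact Finset.card_biUnion_le_card_mul _ _ _ fun B _ => hR C A B
  rw [Nat.card_eq_fintype_card]
  refine h1.trans (h2.trans ?_)
  generalize Fintype.card G.Branch = b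
  have : b ≤ b ^ 3 := Nat.le_self_pow (by norm_num) b
  calc b * (b * (b * N) + 1) = N * b ^ 3 + b := by ring
    _ ≤ N * b ^ 3 + b ^ 3 := by omega
    _ = (N + 1) * b ^ 3 := by ring

end StemCount

end SimpleGraph

theorem mainTheorem7 :
    ∃ K : ℕ, ∀ (V : Type*) [Finite V] (G : SimpleGraph V)
      (P : ∀ A : G.Branch, SimpleGraph.Branch.Coordinate A),
      (SimpleGraph.stems P).ncard ≤ K * Nat.card G.Branch ^ 3 := by
  obtain ⟨N, hN⟩ := SimpleGraph.exists_bound_changes_indistinctPlot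
  exact ⟨N + 1, fun V _ G P => SimpleGraph.ncard_stems_le (hN V G P)⟩
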